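/- Let $k$ be a $\sigma$-field, i.e. a field (of arbitrary characteristic) with an endomorphism $\sigma\colon k\to k$. A $k$-$\sigma$-algebra is a commutative $k$-algebra $S$ with a ring endomorphism $\sigma\colon S\to S$ such that $k\to S$ commutes with $\sigma$; morphisms are the $k$-algebra morphisms that commute with $\sigma$. A group $k$-$\sigma$-scheme $G$ is a functor from $k$-$\sigma$-algebras to groups whose underlying functor to sets is representable, $G\simeq\operatorname{Alg}_k^\sigma(k\{G\},-)$ for a $k$-$\sigma$-algebra $k\{G\}$; morphisms of group $k$-$\sigma$-schemes are morphisms of functors to groups. A normal $\sigma$-closed subgroup $N\trianglelefteq G$ is a subfunctor $N\subset G$ such that $N(S)$ is a normal subgroup of $G(S)$ for every $k$-$\sigma$-algebra $S$ and such that, for some ideal $I$ of $k\{G\}$ with $\sigma(I)\subset I$, there is an isomorphism $N\simeq\operatorname{Alg}_k^\sigma(k\{G\}/I,-)$ compatible with the inclusions into $G\simeq\operatorname{Alg}_k^\sigma(k\{G\},-)$. The kernel of a morphism $\phi\colon G\to H$ of group $k$-$\sigma$-schemes is given by $\ker(\phi)(S)=\ker(\phi(S))$. A quotient of $G$ modulo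 $N$ is a morphism $\pi\colon G\to G/N$ of group $k$-$\sigma$-schemes with $N\subset\ker(\pi)$ such that for every morphism $\phi\colon G\to H$ of group $k$-$\sigma$-schemes with $N\subset\ker(\phi)$ there is a unique morphism $\psi\colon G/N\to H$ of group $k$-$\sigma$-schemes with $\psi\circ\pi=\phi$. **Theorem.** Let $G$ be a group $k$-$\sigma$-scheme and $N\trianglelefteq G$ a normal $\sigma$-closed subgroup. Then a quotient of $G$ modulo $N$ exists, and every quotient $\pi\colon G\to G/N$ of $G$ modulo $N$ satisfies $N=\ker(\pi)$. -/

import Mathlib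

open CategoryTheory Opposite

universe u

namespace DifferenceAlgebra

/-- A difference ring structure (`σ`-ring): a ring together with a ring endomorphism `σ`, which
is not assumed to be injective or surjective. -/
class SigmaRing (R : Type u) [CommRing R] where
  /-- The distinguished endomorphism. -/
  sigma : R →+* R

/-- The distinguished endomorphism of a difference ring. -/
def σ {R : Type u} [CommRing R] [SigmaRing R] : R →+* R := SigmaRing.sigma

/-- A `k`-`σ`-algebra over a `σ`-field `k`: a commutative `k`-algebra with an endomorphism `σ`
such that the structure map commutes with `σ`. -/
structure SigmaAlg (k : Type u) [Field k] [SigmaRing k] where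
  /-- The underlying type. -/
  carrier : Type u
  [commRing : CommRing carrier]
  [algebra : Algebra k carrier]
  [sigmaRing : SigmaRing carrier]
  sigma_algebraMap : ∀ c : k, σ (algebraMap k carrier c) = algebraMap k carrier (σ c)

variable {k : Type u} [Field k] [SigmaRing k]

namespace SigmaAlg

instance : CoeSort (SigmaAlg k) (Type u) := ⟨carrier⟩

attribute [instance] commRing algebra sigmaRing

/-- Morphisms of `k`-`σ`-algebras: `k`-algebra morphisms commuting with `σ`. -/
@[ext]
structure Hom (R S : SigmaAlg k) where
  /-- The underlying `k`-algebra morphism. -/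
  toAlgHom : R →ₐ[k] S
  map_sigma : ∀ r : R, toAlgHom (σ r) = σ (toAlgHom r)

/-- The category of `k`-`σ`-algebras. -/
instance : Category (SigmaAlg k) where
  Hom R S := Hom R S
  id R := ⟨AlgHom.id k R, fun _ => rfl⟩
  comp f g := ⟨g.toAlgHom.comp f.toAlgHom, fun r => by
    simp [f.map_sigma, g.map_sigma]⟩

end SigmaAlg

/-- A `σ`-ideal: an ideal stable under `σ`. -/
structure SigmaIdeal (R : SigmaAlg k) where
  /-- The underlying ideal. -/
  ideal : Ideal R
  sigma_mem : ∀ r ∈ ideal, σ r ∈ ideal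

namespace SigmaIdeal

variable {R : SigmaAlg k} (I : SigmaIdeal R)

/-- The endomorphism of `R / I` induced by `σ`. -/
instance : SigmaRing (R ⧸ I.ideal) where
  sigma := Ideal.quotientMap I.ideal σ (fun r hr => I.sigma_mem r hr)

/-- The quotient `k`-`σ`-algebra `R / I`. -/
def quotient : SigmaAlg k where
  carrier := R ⧸ I.ideal
  sigma_algebraMap c := congrArg (Ideal.Quotient.mk I.ideal) (R.sigma_algebraMap c)

/-- The projection `R → R / I` as a morphism of `k`-`σ`-algebras. -/
def proj : R ⟶ I.quotient where
  toAlgHom := Ideal.Quotient.mkₐ k I.ideal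
  map_sigma _ := rfl

end SigmaIdeal

/-- A `σ`-closed `σ`-subscheme `Y` of a `k`-`σ`-scheme `X`, that is, of a functor from
`k`-`σ`-algebras to sets which is representable by a `k`-`σ`-algebra `k{X}`: the subfunctor `Y`
is represented by `k{X} / I` for some `σ`-ideal `I` of `k{X}`, compatibly with the inclusion into
`X ≃ Alg(k{X}, -)`. Here `k{X}` is `X.coreprX`, and `X.coreprW` is the isomorphism
`Alg(k{X}, -) ≃ X`. -/
def IsSigmaClosed (X : SigmaAlg k ⥤ Type u) [X.IsCorepresentable] (Y : Subfunctor X) : Prop :=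
  ∃ (I : SigmaIdeal X.coreprX) (e : Y.toFunctor ≅ coyoneda.obj (op I.quotient)),
    Y.ι ≫ X.coreprW.inv = e.hom ≫ coyoneda.map I.proj.op

variable (k) in
/-- A group `k`-`σ`-scheme: a functor from `k`-`σ`-algebras to groups whose underlying functor to
sets is representable by a `k`-`σ`-algebra. A morphism of group `k`-`σ`-schemes `G → H` is a
natural transformation `G.toFunctor ⟶ H.toFunctor` of functors to groups. -/
structure GroupSigmaScheme where
  /-- The functor of points. -/
  toFunctor : SigmaAlg k ⥤ GrpCat.{u}
  isCorepresentable : (toFunctor ⋙ forget GrpCat.{u}).IsCorepresentable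

namespace GroupSigmaScheme

attribute [instance] isCorepresentable

/-- The underlying `k`-`σ`-scheme of a group `k`-`σ`-scheme. -/
abbrev points (G : GroupSigmaScheme k) : SigmaAlg k ⥤ Type u :=
  G.toFunctor ⋙ forget GrpCat.{u}

end GroupSigmaScheme

/-- A subfunctor of a group `k`-`σ`-scheme `G` with values in subgroups. -/
@[ext]
structure SubgroupOf (G : GroupSigmaScheme k) where
  /-- The subgroup of `G(S)`. -/
  obj : ∀ S : SigmaAlg k, Subgroup (G.toFunctor.obj S)
  map_mem : ∀ {S T : SigmaAlg k} (f : S ⟶ T), ∀ g ∈ obj S, (G.toFunctor.map f).hom g ∈ obj T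

namespace SubgroupOf

variable {G : GroupSigmaScheme k}

/-- `N ⊆ M` if `N(S) ⊆ M(S)` for every `k`-`σ`-algebra `S`. -/
instance : LE (SubgroupOf G) := ⟨fun N M => ∀ S, N.obj S ≤ M.obj S⟩

/-- The underlying subfunctor of the functor of points of `G`. -/
def toSubfunctor (N : SubgroupOf G) : Subfunctor G.points where
  obj S := {g | g ∈ N.obj S}
  map f g hg := N.map_mem f g hg

/-- `N` is a normal `σ`-closed subgroup of `G`: it is a `σ`-closed `σ`-subscheme of `G`, and
`N(S)` is a normal subgroup of `G(S)` for every `k`-`σ`-algebra `S`. -/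
structure IsNormalSigmaClosed (N : SubgroupOf G) : Prop where
  isSigmaClosed : IsSigmaClosed G.points N.toSubfunctor
  normal : ∀ S : SigmaAlg k, (N.obj S).Normal

end SubgroupOf

/-- The kernel of a morphism of group `k`-`σ`-schemes: `ker(φ)(S) = ker(φ(S))`. -/
def kernel {G H : GroupSigmaScheme k} (φ : G.toFunctor ⟶ H.toFunctor) : SubgroupOf G where
  obj S := (φ.app S).hom.ker
  map_mem {S T} f g hg := by
    have hg' : (φ.app S).hom g = 1 := hg
    have h := ConcreteCategory.congr_hom (φ.naturality f) g
    change (φ.app T).hom ((G.toFunctor.map f).hom g) =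
      (H.toFunctor.map f).hom ((φ.app S).hom g) at h
    change (φ.app T).hom ((G.toFunctor.map f).hom g) = 1
    rw [h, hg', map_one]

/-- `π : G → Q` is a quotient of `G` modulo `N`: `N ⊆ ker(π)`, and every morphism `φ : G → H` of
group `k`-`σ`-schemes with `N ⊆ ker(φ)` factors uniquely through `π`. -/
structure IsQuotient {G : GroupSigmaScheme k} (N : SubgroupOf G) {Q : GroupSigmaScheme k}
    (π : G.toFunctor ⟶ Q.toFunctor) : Prop where
  le_kernel : N ≤ kernel π
  existsUnique_factor : ∀ (H : GroupSigmaScheme k) (φ : G.toFunctor ⟶ H.toFunctor),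
    N ≤ kernel φ → ∃! ψ : Q.toFunctor ⟶ H.toFunctor, π ≫ ψ = φ

end DifferenceAlgebra

/-!
By Yoneda, `G` is the spectrum of a `σ`-Hopf algebra `A`, and `N` is cut out by a `σ`-stable Hopf
ideal `I` that is stable under conjugation. The quotient is the spectrum of the ring of invariants
of `A` under right translation by `N`: normality makes it a Hopf subalgebra, and a morphism `G → H`
kills `N` exactly when its comorphism takes values in the invariants. Every quotient then has a
kernel contained in that of this one, so the theorem amounts to the fact that `I` is generated by
the invariants in the augmentation ideal.

To see that `a ∈ I` lies in the ideal generated by these invariants, put `a` into a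
finite-dimensional subcomodule, with a basis adapted to its intersection with `I`. Its matrix of
coefficients is block triangular modulo `I`, with a diagonal block `P` and a block `Q` with entries
in `I`, and `N` acts on both by right multiplication with the restriction of `P`. The entries of
`Q * adj P` are therefore semi-invariants with the same weight as `f = det P`, and they become
invariants after multiplication by a function `h` of the inverse weight. To find such an `h` with
`h 1 = 1`, take a basis `e` of a space of semi-invariants of this weight that is stable under left
translation, and points `g j` over a `k`-algebra, one of them equal to `1`, such that
`d = det (e i (g j))` is nonzero. Left translation by `n` multiplies `d` by a character `δ n`; since
`n * g j = g j * ((g j)⁻¹ * n * g j)`, for `n` in `N` normality expresses the same factor as the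
product of all `f ((g j)⁻¹ * n * g j)`. Hence `(δ x)⁻¹ * ∏ f ((g j)⁻¹ * x * g j) * d`, with the
product taken over the `g j` other than `1`, has the inverse weight in `x`, and a linear functional
with value `1` at `d` turns it into a function over `k`.
-/

namespace DifferenceAlgebra

open Coalgebra WithConv
open scoped TensorProduct

section LinearAlgebra

variable {k V W ι : Type*} [Field k] [AddCommGroup V] [Module k V] [AddCommGroup W] [Module k W]

theorem exists_dual_family [DecidableEq ι] {e : ι → V} (he : LinearIndependent k e) :
    ∃ φ : ι → Module.Dual k V, ∀ i j, φ i (e j) = if j = i then 1 else 0 := by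
  obtain ⟨g, hg⟩ := LinearMap.exists_leftInverse_of_injective (Finsupp.linearCombination k e)
    (LinearMap.ker_eq_bot.mpr he)
  refine ⟨fun i => Finsupp.lapply i ∘ₗ g, fun i j => ?_⟩
  have hgj : g (e j) = Finsupp.single j 1 := by
    simpa using LinearMap.congr_fun hg (Finsupp.single j 1)
  simp [hgj, Finsupp.single_apply]

theorem sum_tmul_left_injective [Fintype ι] {e : ι → V} (he : LinearIndependent k e) :
    Function.Injective fun z : ι → W => ∑ i, e i ⊗ₜ[k] z i := by
  classical
  obtain ⟨φ, hφ⟩ := exists_dual_family he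
  intro z w h
  funext i
  simpa [hφ] using congrArg (fun x => TensorProduct.lid k W ((φ i).rTensor W x)) h

theorem sum_tmul_right_injective [Fintype ι] {e : ι → V} (he : LinearIndependent k e) :
    Function.Injective fun z : ι → W => ∑ i, z i ⊗ₜ[k] e i := by
  intro z w h
  refine sum_tmul_left_injective he ?_
  simpa using congrArg (TensorProduct.comm k W V) h

theorem exists_basis_sum_adapted_ker (U : Submodule k V) [Module.Finite k U] (π : V →ₗ[k] W) :
    ∃ (p q : ℕ) (b : Module.Basis (Fin p ⊕ Fin q) k U), (∀ i, π (b (.inl i)) = 0) ∧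
      LinearIndependent k (fun j => π (b (.inr j))) := by
  let K : Submodule k U := LinearMap.ker (π ∘ₗ U.subtype)
  obtain ⟨K', hK'⟩ := K.exists_isCompl
  let b := ((Module.finBasis k K).prod (Module.finBasis k K')).map (K.prodEquivOfIsCompl K' hK')
  refine ⟨_, _, b, fun i => ?_, ?_⟩
  · have hbi : (b (.inl i) : V) = Module.finBasis k K i := by simp [b]
    rw [hbi]
    exact (Module.finBasis k K i).2
  · have hker : LinearMap.ker (π ∘ₗ U.subtype ∘ₗ K'.subtype) = ⊥ :=
      LinearMap.ker_eq_bot'.mpr fun m hm =>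
        Subtype.ext (Submodule.disjoint_def.mp hK'.disjoint _ hm m.2)
    simpa [b, Function.comp_def] using (Module.finBasis k K').linearIndependent.map' _ hker

end LinearAlgebra

section Coideals

variable {k C ι : Type*} [CommSemiring k] [AddCommMonoid C] [Module k C] [Coalgebra k C]

/-- A right coideal of a coalgebra: a subspace `V` with `Δ(V) ⊆ V ⊗ C`. -/
def IsRightCoideal (V : Submodule k C) : Prop :=
  ∀ v ∈ V, comul v ∈ LinearMap.range (V.subtype.rTensor C)

/-- A left coideal of a coalgebra: a subspace `V` with `Δ(V) ⊆ C ⊗ V`. -/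
def IsLeftCoideal (V : Submodule k C) : Prop :=
  ∀ v ∈ V, comul v ∈ LinearMap.range (V.subtype.lTensor C)

/-- The left action `φ ⇀ a = ∑ φ(a₂) • a₁` of the dual of a coalgebra. -/
def leftHit (φ : Module.Dual k C) : C →ₗ[k] C :=
  (TensorProduct.rid k C).toLinearMap ∘ₗ φ.lTensor C ∘ₗ comul

/-- The right action `a ↼ φ = ∑ φ(a₁) • a₂` of the dual of a coalgebra. -/
def rightHit (φ : Module.Dual k C) : C →ₗ[k] C :=
  (TensorProduct.lid k C).toLinearMap ∘ₗ φ.rTensor C ∘ₗ comul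

theorem comul_leftHit (φ : Module.Dual k C) (a : C) :
    comul (leftHit φ a) = (leftHit φ).lTensor C (comul a) := by
  let slice (W : Type _) [AddCommMonoid W] [Module k W] : W ⊗[k] C →ₗ[k] W :=
    (TensorProduct.rid k W).toLinearMap ∘ₗ φ.lTensor W
  have h₁ : comul ∘ₗ slice C = slice (C ⊗[k] C) ∘ₗ comul.rTensor C := by
    ext; simp [slice]
  have h₂ : slice (C ⊗[k] C) = (slice C).lTensor C ∘ₗ (TensorProduct.assoc k C C C) := by
    ext; simp [slice]
  calc comul (leftHit φ a) = slice (C ⊗[k] C) (comul.rTensor C (comul a)) :=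
        LinearMap.congr_fun h₁ (comul a)
    _ = (slice C).lTensor C (comul.lTensor C (comul a)) := by
        rw [h₂, ← coassoc_apply]; rfl
    _ = (leftHit φ).lTensor C (comul a) := (LinearMap.lTensor_comp_apply _ _ _ _).symm

theorem comul_rightHit (φ : Module.Dual k C) (a : C) :
    comul (rightHit φ a) = (rightHit φ).rTensor C (comul a) := by
  let slice (W : Type _) [AddCommMonoid W] [Module k W] : C ⊗[k] W →ₗ[k] W :=
    (TensorProduct.lid k W).toLinearMap ∘ₗ φ.rTensor W
  have h₁ : comul ∘ₗ slice C = slice (C ⊗[k] C) ∘ₗ comul.lTensor C := by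
    ext; simp [slice]
  have h₂ : slice (C ⊗[k] C) = (slice C).rTensor C ∘ₗ (TensorProduct.assoc k C C C).symm := by
    ext; simp [slice, TensorProduct.smul_tmul']
  calc comul (rightHit φ a) = slice (C ⊗[k] C) (comul.lTensor C (comul a)) :=
        LinearMap.congr_fun h₁ (comul a)
    _ = (slice C).rTensor C (comul.rTensor C (comul a)) := by
        rw [h₂, ← coassoc_symm_apply]; rfl
    _ = (rightHit φ).rTensor C (comul a) := (LinearMap.rTensor_comp_apply _ _ _ _).symm

@[simp]
theorem leftHit_counit (a : C) : leftHit (counit (R := k)) a = a := by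
  simp [leftHit, lTensor_counit_comul]

@[simp]
theorem rightHit_counit (a : C) : rightHit (counit (R := k)) a = a := by
  simp [rightHit, rTensor_counit_comul]

theorem IsLeftCoideal.rightHit_mem {W : Submodule k C} (hW : IsLeftCoideal W)
    (φ : Module.Dual k C) {w : C} (hw : w ∈ W) : rightHit φ w ∈ W := by
  obtain ⟨z, hz⟩ := hW w hw
  have hslice : rightHit φ w = TensorProduct.lid k W (φ.rTensor W z) := by
    have h : (TensorProduct.lid k C).toLinearMap ∘ₗ φ.rTensor C ∘ₗ W.subtype.lTensor C =
        W.subtype ∘ₗ (TensorProduct.lid k W).toLinearMap ∘ₗ φ.rTensor W := by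
      ext; simp
    rw [rightHit, LinearMap.comp_apply, LinearMap.comp_apply, ← hz]
    exact LinearMap.congr_fun h z
  rw [hslice]
  exact Subtype.property _

theorem exists_finite_isRightCoideal [Module.Free k C] (f : C) :
    ∃ V : Submodule k C, Module.Finite k V ∧ IsRightCoideal V ∧ f ∈ V := by
  let b := Module.Free.chooseBasis k C
  obtain ⟨c, hc⟩ := TensorProduct.eq_repr_basis_right b (comul (R := k) f)
  let V : Submodule k C := Submodule.span k (Set.range c)
  have hcV (i) : c i ∈ V := Submodule.subset_span ⟨i, rfl⟩
  have hhit (φ : Module.Dual k C) : leftHit φ f = c.sum fun i m => φ (b i) • m := by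
    simp [leftHit, ← hc, Finsupp.sum]
  have hcoord (i) : leftHit (b.coord i) f = c i := by
    classical
    simp [hhit, Finsupp.sum, Finsupp.single_apply, eq_comm]
  have hVle : V ≤ (LinearMap.range (V.subtype.rTensor C)).comap comul := by
    refine Submodule.span_le.mpr (Set.range_subset_iff.mpr fun i => ?_)
    rw [SetLike.mem_coe, Submodule.mem_comap, ← hcoord, comul_leftHit, ← hc, Finsupp.sum, map_sum]
    exact Submodule.sum_mem _ fun j _ => ⟨⟨c j, hcV j⟩ ⊗ₜ leftHit (b.coord i) (b j), by simp⟩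
  refine ⟨V, .span_of_finite k c.finite_range, hVle, ?_⟩
  rw [← leftHit_counit (k := k) f, hhit]
  exact Submodule.sum_mem _ fun i _ => V.smul_mem _ (hcV i)

theorem IsLeftCoideal.exists_finite_le [Module.Free k C] {W : Submodule k C} (hW : IsLeftCoideal W)
    {f : C} (hf : f ∈ W) : ∃ V ≤ W, Module.Finite k V ∧ IsLeftCoideal V ∧ f ∈ V := by
  let b := Module.Free.chooseBasis k C
  obtain ⟨c, hc⟩ := TensorProduct.eq_repr_basis_left b (comul (R := k) f)
  let V : Submodule k C := Submodule.span k (Set.range c)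
  have hcV (i) : c i ∈ V := Submodule.subset_span ⟨i, rfl⟩
  have hhit (φ : Module.Dual k C) : rightHit φ f = c.sum fun i m => φ (b i) • m := by
    simp [rightHit, ← hc, Finsupp.sum]
  have hcoord (i) : rightHit (b.coord i) f = c i := by
    classical
    simp [hhit, Finsupp.sum, Finsupp.single_apply, eq_comm]
  have hVle : V ≤ (LinearMap.range (V.subtype.lTensor C)).comap comul := by
    refine Submodule.span_le.mpr (Set.range_subset_iff.mpr fun i => ?_)
    rw [SetLike.mem_coe, Submodule.mem_comap, ← hcoord, comul_rightHit, ← hc, Finsupp.sum, map_sum]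
    exact Submodule.sum_mem _ fun j _ => ⟨rightHit (b.coord i) (b j) ⊗ₜ ⟨c j, hcV j⟩, by simp⟩
  refine ⟨V, ?_, .span_of_finite k c.finite_range, hVle, ?_⟩
  · exact Submodule.span_le.mpr
      (Set.range_subset_iff.mpr fun i => hcoord i ▸ hW.rightHit_mem _ hf)
  · rw [← rightHit_counit (k := k) f, hhit]
    exact Submodule.sum_mem _ fun i _ => V.smul_mem _ (hcV i)

theorem IsRightCoideal.exists_coeff {V : Submodule k C} (hV : IsRightCoideal V)
    [Fintype ι] (b : Module.Basis ι k V) :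
    ∃ t : Matrix ι ι C, ∀ j, comul (R := k) (b j : C) = ∑ i, (b i : C) ⊗ₜ[k] t i j := by
  have h (j) : ∃ t : ι → C, comul (R := k) (b j : C) = ∑ i, (b i : C) ⊗ₜ t i := by
    obtain ⟨z, hz⟩ := hV (b j) (b j).2
    obtain ⟨c, rfl⟩ := TensorProduct.eq_repr_basis_left b z
    exact ⟨c, by simp [← hz, Finsupp.sum_fintype]⟩
  choose t ht using h
  exact ⟨fun i j => t j i, ht⟩

theorem IsLeftCoideal.exists_coeff {V : Submodule k C} (hV : IsLeftCoideal V)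
    [Fintype ι] (b : Module.Basis ι k V) :
    ∃ s : Matrix ι ι C, ∀ i, comul (R := k) (b i : C) = ∑ j, s i j ⊗ₜ[k] (b j : C) := by
  have h (i) : ∃ s : ι → C, comul (R := k) (b i : C) = ∑ j, s j ⊗ₜ (b j : C) := by
    obtain ⟨z, hz⟩ := hV (b i) (b i).2
    obtain ⟨c, rfl⟩ := TensorProduct.eq_repr_basis_right b z
    exact ⟨c, by simp [← hz, Finsupp.sum_fintype]⟩
  choose s hs using h
  exact ⟨s, hs⟩

end Coideals

section MultiplicativeMatrices

variable {ι : Type*} [Fintype ι] [DecidableEq ι]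

/-- A multiplicative matrix over a coalgebra, that is, the matrix of coefficients of a
finite-dimensional comodule: the comultiplication acts by the matrix product and the counit of
the matrix is the identity. -/
structure IsMultiplicativeMatrix (k : Type*) {C : Type*} [CommSemiring k] [AddCommMonoid C]
    [Module k C] [Coalgebra k C] (t : Matrix ι ι C) : Prop where
  comul_apply : ∀ i j, comul (R := k) (t i j) = ∑ l, t i l ⊗ₜ[k] t l j
  map_counit : t.map (counit (R := k)) = 1

variable {k C : Type*} [Field k] [AddCommGroup C] [Module k C] [Coalgebra k C]

theorem IsMultiplicativeMatrix.of_right_coeff {e : ι → C} {t : Matrix ι ι C}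
    (he : LinearIndependent k e) (h : ∀ j, comul (R := k) (e j) = ∑ i, e i ⊗ₜ[k] t i j) :
    IsMultiplicativeMatrix k t where
  comul_apply i j := by
    have hc := coassoc_apply (R := k) (e j)
    simp only [h, map_sum, LinearMap.rTensor_tmul, LinearMap.lTensor_tmul, TensorProduct.sum_tmul,
      TensorProduct.assoc_tmul] at hc
    rw [Finset.sum_comm] at hc
    simp only [← TensorProduct.tmul_sum] at hc
    exact (congrFun (sum_tmul_left_injective he hc) i).symm
  map_counit := by
    ext i j
    have hc := lTensor_counit_comul (R := k) (e j)
    simp only [h, map_sum, LinearMap.lTensor_tmul] at hc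
    have hj : e j ⊗ₜ[k] (1 : k) = ∑ i, e i ⊗ₜ[k] (1 : Matrix ι ι k) i j := by
      simp [Matrix.one_apply, TensorProduct.tmul_ite]
    exact congrFun (sum_tmul_left_injective he (hc.trans hj)) i

theorem IsMultiplicativeMatrix.of_left_coeff {e : ι → C} {s : Matrix ι ι C}
    (he : LinearIndependent k e) (h : ∀ i, comul (R := k) (e i) = ∑ j, s i j ⊗ₜ[k] e j) :
    IsMultiplicativeMatrix k s where
  comul_apply i j := by
    have hc := coassoc_symm_apply (R := k) (e i)
    simp only [h, map_sum, LinearMap.rTensor_tmul, LinearMap.lTensor_tmul, TensorProduct.tmul_sum,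
      TensorProduct.assoc_symm_tmul] at hc
    rw [Finset.sum_comm] at hc
    simp only [← TensorProduct.sum_tmul] at hc
    exact (congrFun (sum_tmul_right_injective he hc) j).symm
  map_counit := by
    ext i j
    have hc := rTensor_counit_comul (R := k) (e i)
    simp only [h, map_sum, LinearMap.rTensor_tmul] at hc
    have hi : (1 : k) ⊗ₜ[k] e i = ∑ j, (1 : Matrix ι ι k) i j ⊗ₜ[k] e j := by
      simp [Matrix.one_apply, TensorProduct.ite_tmul]
    exact congrFun (sum_tmul_right_injective he (hc.trans hi)) j

end MultiplicativeMatrices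

section Points

variable {k A B R S : Type*} [CommRing k] [CommRing A] [CommRing B] [CommRing R]
  [Algebra k R] [CommRing S] [Algebra k S]

/-- The `R`-points `Spec(A)(R)` of the affine group scheme of a commutative Hopf algebra `A`; the
group law is convolution. -/
abbrev Point (k A R : Type*) [CommRing k] [CommRing A] [Algebra k A] [CommRing R]
    [Algebra k R] := WithConv (A →ₐ[k] R)

namespace Point

section Generic

variable [Algebra k A]

variable (k A R) in
/-- The generic point of `Spec(A)`, with values in `A ⊗ R`. -/
noncomputable def generic : Point k A (A ⊗[k] R) :=
  toConv Algebra.TensorProduct.includeLeft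

variable (k) in
/-- The generic point of the closed subscheme of `Spec(A)` defined by `I`, with values in
`A ⊗ A/I`. -/
noncomputable def genericOn (I : Ideal A) : Point k A (A ⊗[k] (A ⧸ I)) :=
  toConv (Algebra.TensorProduct.includeRight.comp (Ideal.Quotient.mkₐ k I))

end Generic

section Group

variable [HopfAlgebra k A]

noncomputable instance : Group (Point k A R) where
  inv g := toConv (g.ofConv.comp (HopfAlgebra.antipodeAlgHom k A))
  inv_mul_cancel g := by
    ext a
    have h := congrArg g.ofConv (HopfAlgebra.sum_antipode_mul_eq_algebraMap_counit (ℛ k a))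
    rw [AlgHom.convMul_apply, ← (ℛ k a).eq]
    simpa using h

theorem inv_apply (g : Point k A R) (a : A) : g⁻¹ a = g (HopfAlgebra.antipode k a) := rfl

theorem mul_apply_of_comul_eq {ι : Type*} {s : Finset ι} {a : A} {x y : ι → A}
    (h : comul (R := k) a = ∑ i ∈ s, x i ⊗ₜ y i) (g g' : Point k A R) :
    (g * g') a = ∑ i ∈ s, g (x i) * g' (y i) := by
  rw [AlgHom.convMul_apply, h, map_sum]
  simp

/-- Functoriality of `Spec(A)(R)` in `R`. -/
def map (φ : R →ₐ[k] S) : Point k A R →* Point k A S where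
  toFun g := toConv (φ.comp g.ofConv)
  map_one' := by ext; simp
  map_mul' g h := WithConv.ext (AlgHom.comp_convMul_distrib φ g h)

@[simp]
theorem map_apply (φ : R →ₐ[k] S) (g : Point k A R) (a : A) : map φ g a = φ (g a) := rfl

/-- Functoriality of `Spec(A)(R)` in `A`. -/
def comap [HopfAlgebra k B] (θ : A →ₐc[k] B) : Point k B R →* Point k A R where
  toFun g := toConv (g.ofConv.comp (θ : A →ₐ[k] B))
  map_one' := by ext; simp
  map_mul' g h := WithConv.ext (AlgHom.convMul_comp_bialgHom_distrib g h θ)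

@[simp]
theorem comap_apply [HopfAlgebra k B] (θ : A →ₐc[k] B) (g : Point k B R) (a : A) :
    comap θ g a = g (θ a) := rfl

theorem exists_map_generic_eq {I : Ideal A} (g : Point k A R) {n : Point k A R}
    (hn : ∀ a ∈ I, n a = 0) : ∃ Φ : A ⊗[k] (A ⧸ I) →ₐ[k] R,
      map Φ (generic k A (A ⧸ I)) = g ∧ map Φ (genericOn k I) = n := by
  refine ⟨Algebra.TensorProduct.lift g.ofConv (Ideal.Quotient.liftₐ I n.ofConv hn)
    fun _ _ => Commute.all _ _, by ext; simp [generic], ?_⟩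
  ext a
  simp only [map_apply, genericOn, AlgHom.comp_apply, Algebra.TensorProduct.includeRight_apply,
    Algebra.TensorProduct.lift_tmul, map_one, one_mul]
  rfl

end Group

end Point

section VanishingOn

variable [HopfAlgebra k A] (I : Ideal A) [I.IsHopfIdeal k]

variable (k R) in
/-- The `R`-points of the closed subgroup scheme of `Spec(A)` defined by a Hopf ideal `I`. -/
noncomputable def vanishingOn : Subgroup (Point k A R) :=
  (Point.comap (Bialgebra.Quotient.mkBialgHom (R := k) I)).range

variable {I}

theorem mem_vanishingOn {n : Point k A R} : n ∈ vanishingOn k R I ↔ ∀ a ∈ I, n a = 0 := by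
  refine ⟨?_, fun hn => ⟨toConv (Ideal.Quotient.liftₐ I n.ofConv hn), rfl⟩⟩
  rintro ⟨g, rfl⟩ a ha
  rw [Point.comap_apply, Bialgebra.Quotient.mkBialgHom_apply, Ideal.Quotient.eq_zero_iff_mem.mpr ha,
    map_zero]

theorem map_mem_vanishingOn (φ : R →ₐ[k] S) {n : Point k A R} (hn : n ∈ vanishingOn k R I) :
    Point.map φ n ∈ vanishingOn k S I :=
  mem_vanishingOn.mpr fun a ha => by rw [Point.map_apply, mem_vanishingOn.mp hn a ha, map_zero]

end VanishingOn

section Coaction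

variable [HopfAlgebra k A] (I : Ideal A)

variable (k) in
/-- The right translation coaction `A → A ⊗ A/I` of the closed subgroup scheme of `Spec(A)`
defined by `I`. -/
noncomputable def coaction : A →ₐ[k] A ⊗[k] (A ⧸ I) :=
  (Algebra.TensorProduct.map (AlgHom.id k A) (Ideal.Quotient.mkₐ k I)).comp
    (Bialgebra.comulAlgHom k A)

variable {I}

theorem coaction_of_comul_eq {ι : Type*} {s : Finset ι} {a : A} {x y : ι → A}
    (h : comul (R := k) a = ∑ i ∈ s, x i ⊗ₜ y i) :
    coaction k I a = ∑ i ∈ s, x i ⊗ₜ Ideal.Quotient.mk I (y i) := by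
  simp [coaction, h]

theorem coaction_eq_mul (a : A) :
    coaction k I a = (Point.generic k A (A ⧸ I) * Point.genericOn k I) a := by
  rw [coaction_of_comul_eq (ℛ k a).eq.symm, Point.mul_apply_of_comul_eq (ℛ k a).eq.symm]
  simp [Point.generic, Point.genericOn]

end Coaction

section SemiInvariants

variable [HopfAlgebra k A] {I : Ideal A}

variable (k I) in
/-- The functions on `Spec(A)` that are semi-invariant of weight `f` under right translation by
the closed subgroup scheme defined by `I`. -/
noncomputable def semiInvariants (f : A) : Submodule k A :=
  LinearMap.eqLocus (coaction k I).toLinearMap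
    ((TensorProduct.mk k A (A ⧸ I)).flip (Ideal.Quotient.mk I f))

theorem mem_semiInvariants {f a : A} :
    a ∈ semiInvariants k I f ↔ coaction k I a = a ⊗ₜ Ideal.Quotient.mk I f := Iff.rfl

theorem mul_apply_of_mem_semiInvariants [I.IsHopfIdeal k] {f a : A} (ha : a ∈ semiInvariants k I f)
    (g : Point k A R) {n : Point k A R} (hn : n ∈ vanishingOn k R I) :
    (g * n) a = g a * n f := by
  obtain ⟨Φ, rfl, rfl⟩ := Point.exists_map_generic_eq g (mem_vanishingOn.mp hn)
  have h := congrArg Φ (mem_semiInvariants.mp ha)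
  rw [coaction_eq_mul, ← Point.map_apply, map_mul] at h
  refine h.trans ?_
  rw [Point.map_apply, Point.map_apply, ← map_mul]
  simp [Point.generic, Point.genericOn]

theorem coaction_colinear (a : A) :
    (coaction k I).toLinearMap.lTensor A (comul a) =
      TensorProduct.assoc k A A (A ⧸ I) (comul.rTensor (A ⧸ I) (coaction k I a)) := by
  have h : (coaction k I).toLinearMap =
      (Ideal.Quotient.mkₐ k I).toLinearMap.lTensor A ∘ₗ comul := rfl
  have hassoc : TensorProduct.assoc k A A (A ⧸ I) ∘ₗ comul.rTensor (A ⧸ I) ∘ₗ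
      (Ideal.Quotient.mkₐ k I).toLinearMap.lTensor A =
      ((Ideal.Quotient.mkₐ k I).toLinearMap.lTensor A).lTensor A ∘ₗ
        TensorProduct.assoc k A A A ∘ₗ comul.rTensor A := by
    ext a b
    simp [← (ℛ k a).eq, TensorProduct.sum_tmul]
  rw [h, LinearMap.lTensor_comp_apply, ← coassoc_apply]
  exact (LinearMap.congr_fun hassoc (comul a)).symm

end SemiInvariants

end Points

section Colinear

variable {k C M : Type*} [CommRing k] [AddCommGroup C] [Module k C] [Coalgebra k C]
  [AddCommGroup M] [Module k M]

theorem isLeftCoideal_eqLocus [Module.Flat k C] {ρ τ : C →ₗ[k] C ⊗[k] M}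
    (hρ : ∀ a, ρ.lTensor C (comul a) = TensorProduct.assoc k C C M (comul.rTensor M (ρ a)))
    (hτ : ∀ a, τ.lTensor C (comul a) = TensorProduct.assoc k C C M (comul.rTensor M (τ a))) :
    IsLeftCoideal (LinearMap.eqLocus ρ τ) := by
  intro a ha
  have h := Module.Flat.eqLocus_lTensor_eq k C ρ τ
  refine h.le ?_
  rw [LinearMap.mem_eqLocus]
  refine (hρ a).trans ?_
  rw [LinearMap.mem_eqLocus.mp ha]
  exact (hτ a).symm

end Colinear

theorem isLeftCoideal_semiInvariants {k A : Type*} [CommRing k] [CommRing A] [HopfAlgebra k A]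
    [Module.Flat k A] {I : Ideal A} (f : A) : IsLeftCoideal (semiInvariants k I f) := by
  refine isLeftCoideal_eqLocus coaction_colinear fun a => ?_
  simp [← (ℛ k a).eq, TensorProduct.sum_tmul]

section Normal

variable {k A R : Type*} [CommRing k] [CommRing A] [HopfAlgebra k A] [CommRing R] [Algebra k R]
  {I : Ideal A}

variable (k) in
/-- A Hopf ideal `I` defining a normal subgroup scheme of `Spec(A)`: the conjugate of the generic
point of `Spec(A/I)` by the generic point of `Spec(A)` vanishes on `I`. -/
class IsNormalHopfIdeal (I : Ideal A) : Prop extends I.IsHopfIdeal k where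
  conj_apply_eq_zero : ∀ a ∈ I,
    (Point.generic k A (A ⧸ I) * Point.genericOn k I * (Point.generic k A (A ⧸ I))⁻¹) a = 0

instance normal_vanishingOn [IsNormalHopfIdeal k I] : (vanishingOn k R I).Normal where
  conj_mem n hn g := by
    refine mem_vanishingOn.mpr fun a ha => ?_
    obtain ⟨Φ, rfl, rfl⟩ := Point.exists_map_generic_eq g (mem_vanishingOn.mp hn)
    rw [← map_inv, ← map_mul, ← map_mul, Point.map_apply,
      IsNormalHopfIdeal.conj_apply_eq_zero a ha, map_zero]

end Normal

section GroupLike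

variable {k A R ι : Type*} [CommRing k] [CommRing A] [CommRing R] [Algebra k R]

theorem IsMultiplicativeMatrix.isGroupLikeElem_det [Bialgebra k A] [Fintype ι] [DecidableEq ι]
    {t : Matrix ι ι A} (ht : IsMultiplicativeMatrix k t) : IsGroupLikeElem k t.det where
  counit_eq_one := by
    rw [← Bialgebra.counitAlgHom_apply, AlgHom.map_det]
    exact (congrArg Matrix.det ht.map_counit).trans Matrix.det_one
  comul_eq_tmul_self := by
    have hcomul : (Bialgebra.comulAlgHom k A).mapMatrix t =
        (Algebra.TensorProduct.includeLeft : A →ₐ[k] A ⊗[k] A).mapMatrix t *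
          (Algebra.TensorProduct.includeRight : A →ₐ[k] A ⊗[k] A).mapMatrix t := by
      ext i j
      simp [Matrix.mul_apply, ht.comul_apply]
    rw [← Bialgebra.comulAlgHom_apply, AlgHom.map_det, hcomul, Matrix.det_mul,
      ← AlgHom.map_det, ← AlgHom.map_det]
    simp

variable [HopfAlgebra k A] {a : A}

namespace Point

theorem mul_apply_of_isGroupLikeElem (ha : IsGroupLikeElem k a) (g h : Point k A R) :
    (g * h) a = g a * h a := by
  simp [AlgHom.convMul_apply, ha.comul_eq_tmul_self]

theorem inv_apply_mul_apply_of_isGroupLikeElem (ha : IsGroupLikeElem k a) (g : Point k A R) :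
    g⁻¹ a * g a = 1 := by
  rw [← mul_apply_of_isGroupLikeElem ha, inv_mul_cancel, AlgHom.convOne_apply, ha.counit_eq_one,
    map_one]

end Point

end GroupLike

section EvalMatrix

variable {k : Type*} {A : Type u} {R S ι κ : Type*} [CommRing k] [CommRing A] [HopfAlgebra k A]
  [CommRing R] [Algebra k R] [CommRing S] [Algebra k S]

/-- The matrix of values of a family of functions on `Spec(A)` at a family of points. -/
def evalMatrix (e : ι → A) (g : κ → Point k A R) : Matrix ι κ R :=
  Matrix.of fun i j => g j (e i)

variable [Fintype ι] [DecidableEq ι]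

theorem map_det_evalMatrix (φ : R →ₐ[k] S) (e : ι → A) (g : ι → Point k A R) :
    φ (evalMatrix e g).det = (evalMatrix e fun j => Point.map φ (g j)).det :=
  AlgHom.map_det _ _

theorem det_evalMatrix_left_mul {e : ι → A} {s : Matrix ι ι A}
    (hs : ∀ i, comul (R := k) (e i) = ∑ j, s i j ⊗ₜ[k] e j) (y : Point k A R)
    (g : ι → Point k A R) :
    (evalMatrix e fun j => y * g j).det = y s.det * (evalMatrix e g).det := by
  rw [AlgHom.map_det, ← Matrix.det_mul]
  congr 1
  ext i j
  exact Point.mul_apply_of_comul_eq (hs i) y (g j)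

theorem det_evalMatrix_right_mul {I : Ideal A} [I.IsHopfIdeal k] {e : ι → A} {f : A}
    (he : ∀ i, e i ∈ semiInvariants k I f) (g : ι → Point k A R) {n : ι → Point k A R}
    (hn : ∀ j, n j ∈ vanishingOn k R I) :
    (evalMatrix e fun j => g j * n j).det = (∏ j, n j f) * (evalMatrix e g).det := by
  rw [← Matrix.det_mul_row]
  congr 1
  ext i j
  exact (mul_apply_of_mem_semiInvariants (he i) (g j) (hn j)).trans (mul_comm _ _)

/-- Compute the values at the points `n * g j = g j * ((g j)⁻¹ * n * g j)` in two ways. -/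
theorem det_apply_mul_det_evalMatrix {I : Ideal A} [IsNormalHopfIdeal k I] {e : ι → A} {f : A}
    {s : Matrix ι ι A} (hs : ∀ i, comul (R := k) (e i) = ∑ j, s i j ⊗ₜ[k] e j)
    (he : ∀ i, e i ∈ semiInvariants k I f) (g : ι → Point k A R) {n : Point k A R}
    (hn : n ∈ vanishingOn k R I) :
    n s.det * (evalMatrix e g).det = (∏ j, ((g j)⁻¹ * n * g j) f) * (evalMatrix e g).det := by
  have hconj (j) : (g j)⁻¹ * n * g j ∈ vanishingOn k R I := by
    simpa using normal_vanishingOn.conj_mem n hn (g j)⁻¹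
  rw [← det_evalMatrix_left_mul hs, ← det_evalMatrix_right_mul he g hconj]
  simp only [mul_assoc, mul_inv_cancel_left]

theorem det_evalMatrix_cons {r : ℕ} (e : Fin (r + 1) → A) (g : Fin r → Point k A R) :
    (evalMatrix e (Fin.cons (Point.generic k A R) fun j =>
      Point.map (Algebra.TensorProduct.includeRight : R →ₐ[k] A ⊗[k] R) (g j))).det =
      ∑ i : Fin (r + 1),
        e i ⊗ₜ[k] ((-1) ^ (i : ℕ) * (evalMatrix (fun l => e (i.succAbove l)) g).det) := by
  rw [Matrix.det_succ_column_zero]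
  refine Finset.sum_congr rfl fun i _ => ?_
  set D := (evalMatrix (fun l => e (i.succAbove l)) g).det with hD
  have hminor := map_det_evalMatrix (Algebra.TensorProduct.includeRight : R →ₐ[k] A ⊗[k] R)
    (fun l => e (i.succAbove l)) g
  rw [← hD, Algebra.TensorProduct.includeRight_apply] at hminor
  calc _ = (-1) ^ (i : ℕ) * (e i ⊗ₜ[k] (1 : R)) * 1 ⊗ₜ D := congrArg _ hminor.symm
    _ = e i ⊗ₜ ((-1) ^ (i : ℕ) * D) := by
        rcases i.val.even_or_odd with h | h <;> simp [h.neg_one_pow, TensorProduct.tmul_neg]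

end EvalMatrix

section GenericPoints

variable {k : Type*} {A : Type u} [Field k] [CommRing A] [HopfAlgebra k A]

theorem exists_det_evalMatrix_ne_zero {r : ℕ} {e : Fin r → A} (he : LinearIndependent k e) :
    ∃ (R : Type u) (_ : CommRing R) (_ : Algebra k R) (g : Fin r → Point k A R),
      (evalMatrix e g).det ≠ 0 := by
  induction r with
  | zero =>
    have := (Bialgebra.counitAlgHom k A).toRingHom.domain_nontrivial
    exact ⟨A, inferInstance, inferInstance, finZeroElim, by simp⟩
  | succ r ih =>
    obtain ⟨R, _, _, g, hg⟩ := ih (he.comp Fin.succ (Fin.succ_injective r))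
    refine ⟨A ⊗[k] R, inferInstance, inferInstance,
      Fin.cons (Point.generic k A R) fun j =>
        Point.map Algebra.TensorProduct.includeRight (g j), fun h => hg ?_⟩
    rw [det_evalMatrix_cons] at h
    have h0 := congrFun (sum_tmul_left_injective he (a₂ := fun _ => (0 : R)) (by simpa using h)) 0
    simpa [Function.comp_def] using h0

theorem exists_det_evalMatrix_ne_zero_of_comul_eq {r : ℕ} {e : Fin r → A}
    (he : LinearIndependent k e) (j₀ : Fin r) {s : Matrix (Fin r) (Fin r) A}
    (hs : ∀ i, comul (R := k) (e i) = ∑ j, s i j ⊗ₜ[k] e j) :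
    ∃ (R : Type u) (_ : CommRing R) (_ : Algebra k R) (g : Fin r → Point k A R), g j₀ = 1 ∧
      (evalMatrix e g).det ≠ 0 := by
  obtain ⟨R, _, _, g, hg⟩ := exists_det_evalMatrix_ne_zero he
  refine ⟨R, inferInstance, inferInstance, fun j => (g j₀)⁻¹ * g j, inv_mul_cancel _,
    fun h => hg ?_⟩
  have hδ := (IsMultiplicativeMatrix.of_left_coeff he hs).isGroupLikeElem_det
  rw [det_evalMatrix_left_mul hs] at h
  calc (evalMatrix e g).det = ((g j₀)⁻¹ s.det * g j₀ s.det) * (evalMatrix e g).det := by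
        rw [Point.inv_apply_mul_apply_of_isGroupLikeElem hδ, one_mul]
    _ = 0 := by rw [mul_right_comm, h, zero_mul]

end GenericPoints

section Slices

variable {k R : Type*} (T : Type*) {A : Type*} [CommRing k] [CommRing R] [Algebra k R] [CommRing T]
  [Algebra k T] [CommRing A] [Algebra k A]

/-- The `T`-linear extension `T ⊗ R → T` of a functional on `R`. -/
noncomputable def slice (φ : Module.Dual k R) : T ⊗[k] R →ₗ[T] T :=
  (TensorProduct.AlgebraTensorModule.rid k T T).toLinearMap ∘ₗ
    TensorProduct.AlgebraTensorModule.lTensor T T φ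

variable {T}

@[simp]
theorem slice_tmul (φ : Module.Dual k R) (t : T) (r : R) : slice T φ (t ⊗ₜ r) = φ r • t := by
  simp [slice]

theorem slice_mul_tmul_one (φ : Module.Dual k R) (w : T ⊗[k] R) (t : T) :
    slice T φ (w * t ⊗ₜ 1) = slice T φ w * t := by
  have h : w * t ⊗ₜ 1 = t • w := by rw [mul_comm, Algebra.smul_def]; rfl
  rw [h, map_smul, smul_eq_mul, mul_comm]

theorem apply_slice (x : A →ₐ[k] T) (φ : Module.Dual k R) (w : A ⊗[k] R) :
    x (slice A φ w) = slice T φ (Algebra.TensorProduct.map x (AlgHom.id k R) w) := by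
  induction w with
  | zero => simp
  | add v w hv hw => simp only [map_add, hv, hw]
  | tmul a r => simp

end Slices

section Twist

variable {k A R S ι : Type*} [CommRing k] [CommRing A] [HopfAlgebra k A] [CommRing R] [Algebra k R]
  [CommRing S] [Algebra k S] [Fintype ι] [DecidableEq ι]

/-- The function `x ↦ δ(x)⁻¹ · ∏_{j ≠ j₀} f(g_j⁻¹ x g_j) · d` on `Spec(A)`. Its weight is inverse
to that of `f` when `d = det (e_i(g_j))` for a basis `e` of a left coideal of semi-invariants of
weight `f` on which `Spec(A)` acts with determinant `δ`. -/
noncomputable def twist (f δ : A) (j₀ : ι) (g : ι → Point k A R) (d : R) (x : Point k A R) : R :=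
  x⁻¹ δ * (∏ j ∈ Finset.univ.erase j₀, ((g j)⁻¹ * x * g j) f) * d

theorem map_twist (φ : R →ₐ[k] S) (f δ : A) (j₀ : ι) (g : ι → Point k A R) (d : R)
    (x : Point k A R) : φ (twist f δ j₀ g d x) =
      twist f δ j₀ (fun j => Point.map φ (g j)) (φ d) (Point.map φ x) := by
  simp only [twist, map_mul, map_prod, ← map_inv, Point.map_apply, ← Point.map_apply φ (_ * _)]

theorem twist_one {f δ : A} (hf : counit (R := k) f = 1) (hδ : counit (R := k) δ = 1) (j₀ : ι)
    (g : ι → Point k A R) (d : R) : twist f δ j₀ g d 1 = d := by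
  simp [twist, hf, hδ]

theorem twist_mul_mul_apply {I : Ideal A} [IsNormalHopfIdeal k I] {f δ : A}
    (hf : f ∈ semiInvariants k I f) (hδ : IsGroupLikeElem k δ) {j₀ : ι} {g : ι → Point k A R}
    (hg : g j₀ = 1) {d : R} (x : Point k A R) {n : Point k A R} (hn : n ∈ vanishingOn k R I)
    (hd : n δ * d = (∏ j, ((g j)⁻¹ * n * g j) f) * d) :
    twist f δ j₀ g d (x * n) * n f = twist f δ j₀ g d x := by
  have hweight (j) : ((g j)⁻¹ * (x * n) * g j) f =
      ((g j)⁻¹ * x * g j) f * ((g j)⁻¹ * n * g j) f := by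
    have hconj : (g j)⁻¹ * n * g j ∈ vanishingOn k R I := by
      simpa using normal_vanishingOn.conj_mem n hn (g j)⁻¹
    rw [← mul_apply_of_mem_semiInvariants hf _ hconj]
    congr 1
    group
  have hinv : (x * n)⁻¹ δ = n⁻¹ δ * x⁻¹ δ := by
    rw [mul_inv_rev, Point.mul_apply_of_isGroupLikeElem hδ]
  have hcancel := Point.inv_apply_mul_apply_of_isGroupLikeElem hδ n
  rw [← Finset.prod_erase_mul _ _ (Finset.mem_univ j₀), hg, inv_one, one_mul, mul_one] at hd
  simp only [twist, hinv, hweight, Finset.prod_mul_distrib]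
  linear_combination
    (-n⁻¹ δ * x⁻¹ δ * ∏ j ∈ Finset.univ.erase j₀, ((g j)⁻¹ * x * g j) f) * hd +
      (x⁻¹ δ * (∏ j ∈ Finset.univ.erase j₀, ((g j)⁻¹ * x * g j) f) * d) * hcancel

/-- The function on `Spec(A)` obtained from the twist at the generic point of `Spec(A)` by applying
a functional to the ring of coefficients `R` of the points `g`. -/
noncomputable def slicedTwist (φ : Module.Dual k R) (f δ : A) (j₀ : ι) (g : ι → Point k A R)
    (d : R) : A :=
  slice A φ (twist f δ j₀ (fun j => Point.map Algebra.TensorProduct.includeRight (g j))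
    (1 ⊗ₜ d) (Point.generic k A R))

theorem apply_slicedTwist (φ : Module.Dual k R) (f δ : A) (j₀ : ι) (g : ι → Point k A R) (d : R)
    (x : Point k A S) : x (slicedTwist φ f δ j₀ g d) =
      slice S φ (twist f δ j₀ (fun j => Point.map Algebra.TensorProduct.includeRight (g j))
        (1 ⊗ₜ d) (Point.map Algebra.TensorProduct.includeLeft x)) := by
  rw [slicedTwist, apply_slice, map_twist]
  congr 2
  · funext j
    ext b
    simp
  · simp

end Twist

theorem genericOn_mem_vanishingOn {k A : Type*} [CommRing k] [CommRing A] [HopfAlgebra k A]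
    {I : Ideal A} [I.IsHopfIdeal k] : Point.genericOn k I ∈ vanishingOn k (A ⊗[k] (A ⧸ I)) I :=
  mem_vanishingOn.mpr fun a ha => by
    simp [Point.genericOn, Ideal.Quotient.eq_zero_iff_mem.mpr ha]

theorem coaction_slicedTwist_mul {k A R ι : Type*} [CommRing k] [CommRing A] [HopfAlgebra k A]
    [CommRing R] [Algebra k R] [Fintype ι] [DecidableEq ι] {I : Ideal A} [IsNormalHopfIdeal k I]
    {f : A} (hf : f ∈ semiInvariants k I f) {e : ι → A} (he : ∀ i, e i ∈ semiInvariants k I f)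
    {s : Matrix ι ι A} (hs : ∀ i, comul (R := k) (e i) = ∑ j, s i j ⊗ₜ[k] e j)
    (hδ : IsGroupLikeElem k s.det) {j₀ : ι} {g : ι → Point k A R} (hg : g j₀ = 1)
    (φ : Module.Dual k R) :
    coaction k I (slicedTwist φ f s.det j₀ g (evalMatrix e g).det) * 1 ⊗ₜ Ideal.Quotient.mk I f =
      slicedTwist φ f s.det j₀ g (evalMatrix e g).det ⊗ₜ 1 := by
  let T := A ⊗[k] (A ⧸ I)
  let incl : T →ₐ[k] T ⊗[k] R := Algebra.TensorProduct.includeLeft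
  let x := Point.generic k A (A ⧸ I)
  let n := Point.genericOn k I
  let G (j : ι) : Point k A (T ⊗[k] R) := Point.map Algebra.TensorProduct.includeRight (g j)
  have hn : Point.map incl n ∈ vanishingOn k (T ⊗[k] R) I :=
    map_mem_vanishingOn _ genericOn_mem_vanishingOn
  have hd := det_apply_mul_det_evalMatrix hs he G hn
  rw [← map_det_evalMatrix] at hd
  have htwist := twist_mul_mul_apply hf hδ (by simp [G, hg] : G j₀ = 1) (Point.map incl x) hn hd
  rw [← map_mul] at htwist
  have hslice := congrArg (slice T φ) htwist
  rw [Point.map_apply] at hslice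
  rw [coaction_eq_mul, apply_slicedTwist]
  refine (slice_mul_tmul_one φ _ (n f)).symm.trans (hslice.trans ?_)
  exact (apply_slicedTwist φ f s.det j₀ g (evalMatrix e g).det x).symm

theorem exists_inverse_weight {k : Type*} {A : Type u} [Field k] [CommRing A] [HopfAlgebra k A]
    {I : Ideal A} [IsNormalHopfIdeal k I] {f : A} (hf : f ∈ semiInvariants k I f)
    (hf₁ : counit (R := k) f = 1) : ∃ h : A, counit (R := k) h = 1 ∧
      coaction k I h * 1 ⊗ₜ Ideal.Quotient.mk I f = h ⊗ₜ 1 := by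
  classical
  obtain ⟨V, hVle, hVfin, hV, hfV⟩ := (isLeftCoideal_semiInvariants f).exists_finite_le hf
  let b := Module.finBasis k V
  have hb : LinearIndependent k fun j => (b j : A) :=
    b.linearIndependent.map' V.subtype V.ker_subtype
  obtain ⟨s, hs⟩ := hV.exists_coeff b
  have hδ := (IsMultiplicativeMatrix.of_left_coeff hb hs).isGroupLikeElem_det
  have hfV₀ : (⟨f, hfV⟩ : V) ≠ 0 := by
    rintro h
    obtain rfl : f = 0 := congrArg Subtype.val h
    simp at hf₁
  obtain ⟨j₀⟩ : Nonempty (Fin (Module.finrank k V)) :=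
    have := nontrivial_of_ne _ _ hfV₀
    b.index_nonempty
  obtain ⟨R, _, _, g, hg, hD⟩ := exists_det_evalMatrix_ne_zero_of_comul_eq hb j₀ hs
  obtain ⟨φ, hφ⟩ := Module.Projective.exists_dual_eq_one k hD
  refine ⟨_, ?_, coaction_slicedTwist_mul hf (fun j => hVle (b j).2) hs hδ hg φ⟩
  have h := apply_slicedTwist φ f s.det j₀ g (evalMatrix (fun j => (b j : A)) g).det
    (1 : Point k A k)
  rw [map_one, twist_one hf₁ hδ.counit_eq_one, slice_tmul, hφ] at h
  simpa using h

section Invariants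

variable {k A : Type*} [CommRing k] [CommRing A] [HopfAlgebra k A] {I : Ideal A}

variable (k I) in
/-- The functions on `Spec(A)` that are invariant under right translation by the closed subgroup
scheme defined by `I`. -/
noncomputable def invariants : Subalgebra k A :=
  AlgHom.equalizer (coaction k I) Algebra.TensorProduct.includeLeft

theorem mem_invariants {a : A} : a ∈ invariants k I ↔ coaction k I a = a ⊗ₜ 1 := Iff.rfl

theorem mul_mem_invariants {f h a : A} (hh : coaction k I h * 1 ⊗ₜ Ideal.Quotient.mk I f = h ⊗ₜ 1)
    (ha : a ∈ semiInvariants k I f) : h * a ∈ invariants k I := by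
  have hsplit : a ⊗ₜ[k] Ideal.Quotient.mk I f = 1 ⊗ₜ Ideal.Quotient.mk I f * a ⊗ₜ 1 := by simp
  rw [mem_invariants, map_mul, mem_semiInvariants.mp ha, hsplit, ← mul_assoc, hh]
  simp

variable (k) in
/-- The ideal of `A` generated by the augmentation ideal of a subalgebra `B`; it defines the kernel
of `Spec(A) → Spec(B)` when `B` is a Hopf subalgebra. -/
def augmentationSpan (B : Subalgebra k A) : Ideal A :=
  Ideal.span {b | b ∈ B ∧ counit (R := k) b = 0}

theorem sub_counit_mem_augmentationSpan {B : Subalgebra k A} {b : A} (hb : b ∈ B) :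
    b - algebraMap k A (counit b) ∈ augmentationSpan k B :=
  Ideal.subset_span ⟨sub_mem hb (Subalgebra.algebraMap_mem _ _), by simp⟩

theorem augmentationSpan_invariants_le : augmentationSpan k (invariants k I) ≤ I := by
  refine Ideal.span_le.mpr fun b ⟨hb, hb₀⟩ => Ideal.Quotient.eq_zero_iff_mem.mp ?_
  let ε := Algebra.TensorProduct.lift ((Algebra.ofId k (A ⧸ I)).comp (Bialgebra.counitAlgHom k A))
    (AlgHom.id k (A ⧸ I)) fun _ _ => Commute.all _ _
  have hε : ε (coaction k I b) = Ideal.Quotient.mk I b := by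
    rw [coaction_of_comul_eq (ℛ k b).eq.symm]
    conv_rhs => rw [← sum_counit_smul (ℛ k b)]
    simp [ε, Algebra.ofId_apply, Algebra.smul_def]
  rw [← hε, mem_invariants.mp hb]
  simp [ε, hb₀]

end Invariants

section BlockTriangular

variable {k A ι κ : Type*} [CommRing A] {I : Ideal A}
  {t : Matrix (ι ⊕ κ) (ι ⊕ κ) A}

theorem toBlocks₂₁_mem_of_comul_eq [Field k] [HopfAlgebra k A] [I.IsHopfIdeal k] [Fintype ι]
    [Fintype κ] {e : ι ⊕ κ → A}
    (ht : ∀ j, comul (R := k) (e j) = ∑ i, e i ⊗ₜ[k] t i j) (heI : ∀ i, e (.inl i) ∈ I)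
    (he : LinearIndependent k fun l => Ideal.Quotient.mkₐ k I (e (.inr l))) (l : κ) (j : ι) :
    t.toBlocks₂₁ l j ∈ I := by
  let π := Ideal.Quotient.mkₐ k I
  have hπ (i) : π (e (.inl i)) = 0 := Ideal.Quotient.eq_zero_iff_mem.mpr (heI i)
  have hcomul : TensorProduct.map π.toLinearMap π.toLinearMap (comul (e (.inl j))) = 0 := by
    have h := CoalgHomClass.map_comp_comul_apply (Bialgebra.Quotient.mkBialgHom (R := k) I)
      (e (.inl j))
    refine h.trans ?_
    rw [Bialgebra.Quotient.mkBialgHom_apply, Ideal.Quotient.eq_zero_iff_mem.mpr (heI j), map_zero]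
  have hsum : ∑ l, π (e (.inr l)) ⊗ₜ[k] π (t (.inr l) (.inl j)) =
      ∑ l, π (e (.inr l)) ⊗ₜ[k] 0 := by
    simpa [ht, hπ] using hcomul
  exact Ideal.Quotient.eq_zero_iff_mem.mp (congrFun (sum_tmul_left_injective he hsum) l)

theorem mem_of_mul_adjugate_mem [Fintype ι] [DecidableEq ι] {P : Matrix ι ι A} {Q : Matrix κ ι A}
    {h : A} (hP : h * P.det - 1 ∈ I) (hQ : ∀ l j, h * (Q * P.adjugate) l j ∈ I) (l : κ) (j : ι) :
    Q l j ∈ I := by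
  have hadj : ∑ i, h * (Q * P.adjugate) l i * P i j = h * P.det * Q l j := by
    simp only [mul_assoc h, ← Finset.mul_sum]
    rw [← Matrix.mul_apply, Matrix.mul_assoc, Matrix.adjugate_mul, Matrix.mul_smul, Matrix.mul_one]
    rfl
  have hsum : h * P.det * Q l j ∈ I :=
    hadj ▸ Ideal.sum_mem _ fun i _ => I.mul_mem_right _ (hQ l i)
  have hsub := I.sub_mem hsum (I.mul_mem_right (Q l j) hP)
  rwa [sub_mul, one_mul, sub_sub_cancel] at hsub

variable [CommRing k] [HopfAlgebra k A] [Fintype ι] [DecidableEq ι] [Fintype κ] [DecidableEq κ]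

theorem IsMultiplicativeMatrix.coaction_apply_inl (ht : IsMultiplicativeMatrix k t)
    (hI : ∀ l j, t.toBlocks₂₁ l j ∈ I) (i : ι ⊕ κ) (j : ι) :
    coaction k I (t i (.inl j)) =
      ∑ l, t i (.inl l) ⊗ₜ Ideal.Quotient.mk I (t (.inl l) (.inl j)) := by
  have hzero (l) : Ideal.Quotient.mk I (t (.inr l) (.inl j)) = 0 :=
    Ideal.Quotient.eq_zero_iff_mem.mpr (hI l j)
  simp [coaction_of_comul_eq (ht.comul_apply i (.inl j)), hzero]

end BlockTriangular

section SemiInvariantMatrices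

variable {k A ι κ : Type*} [CommRing k] [CommRing A] [HopfAlgebra k A] {I : Ideal A} [Fintype ι]
  {P : Matrix ι ι A}

theorem map_coaction_eq_mul {Q : Matrix κ ι A}
    (hQ : ∀ l j, coaction k I (Q l j) = ∑ i, Q l i ⊗ₜ Ideal.Quotient.mk I (P i j)) :
    Q.map (coaction k I) = Q.map (Point.generic k A (A ⧸ I)) * P.map (Point.genericOn k I) := by
  ext l j
  simp [Matrix.mul_apply, hQ, Point.generic, Point.genericOn]

variable [DecidableEq ι]

theorem det_mem_semiInvariants
    (hP : ∀ i j, coaction k I (P i j) = ∑ l, P i l ⊗ₜ Ideal.Quotient.mk I (P l j)) :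
    P.det ∈ semiInvariants k I P.det := by
  rw [mem_semiInvariants, AlgHom.map_det]
  refine (congrArg Matrix.det (map_coaction_eq_mul hP)).trans ?_
  rw [Matrix.det_mul]
  refine (congrArg₂ _ (AlgHom.map_det (Point.generic k A (A ⧸ I)).ofConv P).symm
    (AlgHom.map_det (Point.genericOn k I).ofConv P).symm).trans ?_
  simp [Point.generic, Point.genericOn]

theorem mul_adjugate_mem_semiInvariants {Q : Matrix κ ι A}
    (hP : ∀ i j, coaction k I (P i j) = ∑ l, P i l ⊗ₜ Ideal.Quotient.mk I (P l j))
    (hQ : ∀ l j, coaction k I (Q l j) = ∑ i, Q l i ⊗ₜ Ideal.Quotient.mk I (P i j)) (l : κ)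
    (j : ι) : (Q * P.adjugate) l j ∈ semiInvariants k I P.det := by
  let x := (Point.generic k A (A ⧸ I)).ofConv
  let n := (Point.genericOn k I).ofConv
  have hmap : (Q * P.adjugate).map (coaction k I) = n P.det • (Q * P.adjugate).map x :=
    calc (Q * P.adjugate).map (coaction k I)
        = Q.map (coaction k I) * (P.map (coaction k I)).adjugate := by
          rw [Matrix.map_mul]
          exact congrArg _ (AlgHom.map_adjugate _ _)
      _ = Q.map x * (P.map n * (P.map n).adjugate) * (P.map x).adjugate := by
          rw [map_coaction_eq_mul hQ, map_coaction_eq_mul hP, Matrix.adjugate_mul_distrib]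
          simp only [Matrix.mul_assoc]
          rfl
      _ = n P.det • (Q.map x * (P.map x).adjugate) := by
          rw [Matrix.mul_adjugate, Matrix.mul_smul (Q.map x) (P.map n).det 1, Matrix.mul_one,
            Matrix.smul_mul]
          exact congrArg (· • _) (AlgHom.map_det n P).symm
      _ = n P.det • (Q * P.adjugate).map x := by
          rw [Matrix.map_mul]
          exact congrArg (fun M => _ • (_ * M)) (AlgHom.map_adjugate x P).symm
  refine (congrFun₂ hmap l j).trans ?_
  simp [x, n, Point.generic, Point.genericOn, -Matrix.map_mul]

end SemiInvariantMatrices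

theorem IsMultiplicativeMatrix.toBlocks₂₁_mem_augmentationSpan {k : Type*} {A : Type u}
    {ι κ : Type*} [Field k] [CommRing A] [HopfAlgebra k A] {I : Ideal A} [IsNormalHopfIdeal k I]
    [Fintype ι] [DecidableEq ι] [Fintype κ] [DecidableEq κ] {t : Matrix (ι ⊕ κ) (ι ⊕ κ) A}
    (ht : IsMultiplicativeMatrix k t) (hI : ∀ l j, t.toBlocks₂₁ l j ∈ I) (l : κ) (j : ι) :
    t.toBlocks₂₁ l j ∈ augmentationSpan k (invariants k I) := by
  have hP (i j : ι) := ht.coaction_apply_inl hI (.inl i) j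
  have hQ (l : κ) (j : ι) := ht.coaction_apply_inl hI (.inr l) j
  have hεP : t.toBlocks₁₁.map (counit (R := k)) = 1 := by
    ext i j
    simpa [Matrix.one_apply, Matrix.toBlocks₁₁] using congrFun₂ ht.map_counit (.inl i) (.inl j)
  have hεQ : t.toBlocks₂₁.map (counit (R := k)) = 0 := by
    ext l j
    simpa [Matrix.toBlocks₂₁] using congrFun₂ ht.map_counit (.inr l) (.inl j)
  have hdet := det_mem_semiInvariants (P := t.toBlocks₁₁) hP
  have hεdet : counit (R := k) t.toBlocks₁₁.det = 1 :=
    (AlgHom.map_det (Bialgebra.counitAlgHom k A) _).trans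
      ((congrArg Matrix.det hεP).trans Matrix.det_one)
  obtain ⟨h, hh₁, hh⟩ := exists_inverse_weight hdet hεdet
  refine mem_of_mul_adjugate_mem (h := h) (P := t.toBlocks₁₁) ?_ (fun l j => ?_) l j
  · simpa [hh₁, hεdet] using sub_counit_mem_augmentationSpan (mul_mem_invariants hh hdet)
  · refine Ideal.subset_span
      ⟨mul_mem_invariants hh (mul_adjugate_mem_semiInvariants hP hQ l j), ?_⟩
    have hQ₀ (i) : counit (R := k) (t.toBlocks₂₁ l i) = 0 := congrFun₂ hεQ l i
    simp [Matrix.mul_apply, hQ₀]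

theorem augmentationSpan_invariants {k : Type*} {A : Type u} [Field k] [CommRing A]
    [HopfAlgebra k A] (I : Ideal A) [IsNormalHopfIdeal k I] :
    augmentationSpan k (invariants k I) = I := by
  refine le_antisymm augmentationSpan_invariants_le fun f hf => ?_
  obtain ⟨V, hVfin, hV, hfV⟩ := exists_finite_isRightCoideal (k := k) f
  obtain ⟨p, q, b, hbI, hb⟩ := exists_basis_sum_adapted_ker V (Ideal.Quotient.mkₐ k I).toLinearMap
  obtain ⟨t, ht⟩ := hV.exists_coeff b
  have hmem (i) : (b (.inl i) : A) ∈ I := Ideal.Quotient.eq_zero_iff_mem.mp (hbI i)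
  have hcounit (i) : counit (R := k) (b (.inl i) : A) = 0 :=
    Submodule.IsCoideal.counit_eq_zero (I := I.restrictScalars k) (hmem i)
  have htmul := IsMultiplicativeMatrix.of_right_coeff
    (b.linearIndependent.map' V.subtype V.ker_subtype) ht
  have htJ := htmul.toBlocks₂₁_mem_augmentationSpan (toBlocks₂₁_mem_of_comul_eq ht hmem hb)
  have hbJ (j) : (b (.inl j) : A) ∈ augmentationSpan k (invariants k I) := by
    have h : (b (.inl j) : A) = ∑ l, counit (R := k) (b (.inr l) : A) • t (.inr l) (.inl j) := by
      have h := rightHit_counit (k := k) (b (.inl j) : A)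
      rw [rightHit, LinearMap.comp_apply, LinearMap.comp_apply, ht] at h
      simpa [hcounit] using h.symm
    rw [h]
    exact Ideal.sum_mem _ fun l _ => Submodule.smul_of_tower_mem _ _ (htJ l j)
  let c := b.repr ⟨f, hfV⟩
  have hsum : ∑ i, c (.inl i) • (b (.inl i) : A) + ∑ l, c (.inr l) • (b (.inr l) : A) = f := by
    simpa only [c, Fintype.sum_sum_type, Submodule.coe_add, Submodule.coe_sum, Submodule.coe_smul]
      using congrArg Subtype.val (b.sum_repr ⟨f, hfV⟩)
  have hinr : ∀ l, c (.inr l) = 0 := by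
    refine Fintype.linearIndependent_iff.mp hb _ ?_
    have h := congrArg (Ideal.Quotient.mkₐ k I) hsum
    simpa [map_add, map_sum, Ideal.Quotient.eq_zero_iff_mem.mpr (hmem _),
      Ideal.Quotient.eq_zero_iff_mem.mpr hf] using h
  rw [← hsum]
  simp only [hinr, zero_smul, Finset.sum_const_zero, add_zero]
  exact Ideal.sum_mem _ fun i _ => Submodule.smul_of_tower_mem _ _ (hbJ i)

section HopfSubalgebras

variable {k A : Type*} [Field k]

/-- The coalgebra structure induced along an injective map `v` into a coalgebra by a lift of the
comultiplication. -/
abbrev coalgebraOfInjective {B C : Type*} [AddCommGroup B] [Module k B] [AddCommGroup C]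
    [Module k C] [Coalgebra k C] (v : B →ₗ[k] C) (hv : Function.Injective v)
    (Δ : B →ₗ[k] B ⊗[k] B) (hΔ : TensorProduct.map v v ∘ₗ Δ = comul ∘ₗ v) : Coalgebra k B where
  comul := Δ
  counit := counit ∘ₗ v
  coassoc := by
    have hv₂ := TensorProduct.map_injective_of_flat_flat v v hv hv
    have hv₃ := TensorProduct.map_injective_of_flat_flat v (TensorProduct.map v v) hv hv₂
    have hassoc : TensorProduct.map v (TensorProduct.map v v) ∘ₗ TensorProduct.assoc k B B B =
        TensorProduct.assoc k C C C ∘ₗ TensorProduct.map (TensorProduct.map v v) v := by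
      ext; rfl
    refine (LinearMap.cancel_left hv₃).mp ?_
    calc _ = TensorProduct.assoc k C C C ∘ₗ TensorProduct.map (comul ∘ₗ v) v ∘ₗ Δ := by
          rw [← LinearMap.comp_assoc, hassoc, LinearMap.comp_assoc, ← LinearMap.comp_assoc Δ,
            LinearMap.map_comp_rTensor, hΔ]
      _ = (TensorProduct.assoc k C C C ∘ₗ comul.rTensor C ∘ₗ comul) ∘ₗ v := by
          rw [← LinearMap.rTensor_comp_map, LinearMap.comp_assoc, hΔ, LinearMap.comp_assoc,
            LinearMap.comp_assoc]
      _ = comul.lTensor C ∘ₗ TensorProduct.map v v ∘ₗ Δ := by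
          rw [coassoc, LinearMap.comp_assoc, hΔ]
      _ = _ := by
          rw [← LinearMap.comp_assoc, ← LinearMap.comp_assoc, LinearMap.lTensor_comp_map, ← hΔ,
            LinearMap.map_comp_lTensor]
  rTensor_counit_comp_comul := by
    refine (LinearMap.cancel_left (Module.Flat.lTensor_preserves_injective_linearMap v hv)).mp ?_
    rw [← LinearMap.comp_assoc, LinearMap.lTensor_comp_rTensor, ← LinearMap.rTensor_comp_map,
      LinearMap.comp_assoc, hΔ, ← LinearMap.comp_assoc, rTensor_counit_comp_comul]
    ext; simp
  lTensor_counit_comp_comul := by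
    refine (LinearMap.cancel_left (Module.Flat.rTensor_preserves_injective_linearMap v hv)).mp ?_
    rw [← LinearMap.comp_assoc, LinearMap.rTensor_comp_lTensor, ← LinearMap.lTensor_comp_map,
      LinearMap.comp_assoc, hΔ, ← LinearMap.comp_assoc, lTensor_counit_comp_comul]
    ext; simp

variable [CommRing A] [HopfAlgebra k A]

variable (k) in
/-- A Hopf subalgebra of a Hopf algebra over a field. -/
class IsHopfSubalgebra (B : Subalgebra k A) : Prop where
  comul_mem : ∀ b ∈ B, comul (R := k) b ∈ (Algebra.TensorProduct.map B.val B.val).range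
  antipode_mem : ∀ b ∈ B, HopfAlgebra.antipode k b ∈ B

namespace IsHopfSubalgebra

variable {B : Subalgebra k A}

theorem map_val_val_injective : Function.Injective (Algebra.TensorProduct.map B.val B.val) :=
  TensorProduct.map_injective_of_flat_flat B.val.toLinearMap B.val.toLinearMap
    Subtype.val_injective Subtype.val_injective

variable [IsHopfSubalgebra k B]

variable (B) in
/-- The comultiplication of a Hopf subalgebra. -/
noncomputable def comulHom : B →ₐ[k] B ⊗[k] B :=
  (AlgEquiv.ofInjective _ map_val_val_injective).symm.toAlgHom.comp
    (((Bialgebra.comulAlgHom k A).comp B.val).codRestrict _ fun b => comul_mem (b : A) b.2)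

theorem map_val_val_comulHom (b : B) :
    Algebra.TensorProduct.map B.val B.val (comulHom B b) = comul (b : A) :=
  congrArg Subtype.val ((AlgEquiv.ofInjective _ map_val_val_injective).apply_symm_apply
    (((Bialgebra.comulAlgHom k A).comp B.val).codRestrict _ (fun b => comul_mem (b : A) b.2) b))

noncomputable instance : Bialgebra k B :=
  letI := coalgebraOfInjective B.val.toLinearMap Subtype.val_injective (comulHom B).toLinearMap
    (LinearMap.ext map_val_val_comulHom)
  .mk' k B (map_one ((Bialgebra.counitAlgHom k A).comp B.val))
    (map_mul ((Bialgebra.counitAlgHom k A).comp B.val) _ _) (map_one (comulHom B))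
    (map_mul (comulHom B) _ _)

theorem map_val_val_comul (b : B) :
    Algebra.TensorProduct.map B.val B.val (comul (R := k) b) = comul (b : A) :=
  map_val_val_comulHom b

noncomputable instance : HopfAlgebra k B where
  antipode := (((HopfAlgebra.antipodeAlgHom k A).comp B.val).codRestrict B
    fun b => antipode_mem (b : A) b.2).toLinearMap
  mul_antipode_rTensor_comul := by
    ext b
    refine .trans ?_ (HopfAlgebra.mul_antipode_rTensor_comul_apply (R := k) (b : A))
    rw [← map_val_val_comul]
    simp only [LinearMap.coe_comp, Function.comp_apply, ← (ℛ k b).eq, map_sum,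
      LinearMap.rTensor_tmul, AlgHom.toLinearMap_apply, LinearMap.mul'_apply,
      AddSubmonoidClass.coe_finsetSum, MulMemClass.coe_mul, Algebra.TensorProduct.map_tmul,
      Subalgebra.coe_val]
    rfl
  mul_antipode_lTensor_comul := by
    ext b
    refine .trans ?_ (HopfAlgebra.mul_antipode_lTensor_comul_apply (R := k) (b : A))
    rw [← map_val_val_comul]
    simp only [LinearMap.coe_comp, Function.comp_apply, ← (ℛ k b).eq, map_sum,
      LinearMap.lTensor_tmul, AlgHom.toLinearMap_apply, LinearMap.mul'_apply,
      AddSubmonoidClass.coe_finsetSum, MulMemClass.coe_mul, Algebra.TensorProduct.map_tmul,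
      Subalgebra.coe_val]
    rfl

variable (B) in
/-- The inclusion of a Hopf subalgebra. -/
noncomputable def val : B →ₐc[k] A :=
  .ofAlgHom B.val rfl (AlgHom.ext map_val_val_comul)

/-- A morphism of Hopf algebras whose image lies in `B`, as a morphism to `B`. -/
noncomputable def codRestrict {C : Type*} [CommRing C] [HopfAlgebra k C] (θ : C →ₐc[k] A)
    (hθ : ∀ c, θ c ∈ B) : C →ₐc[k] B :=
  let θ' := (θ : C →ₐ[k] A).codRestrict B hθ
  have hcomp : (Algebra.TensorProduct.map B.val B.val).comp (Algebra.TensorProduct.map θ' θ') =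
      Algebra.TensorProduct.map (θ : C →ₐ[k] A) (θ : C →ₐ[k] A) :=
    Algebra.TensorProduct.ext' fun _ _ => rfl
  .ofAlgHom θ' (AlgHom.ext (CoalgHomClass.counit_comp_apply θ)) <| AlgHom.ext fun c =>
    map_val_val_injective <| (AlgHom.congr_fun hcomp (comul c)).trans <|
      (CoalgHomClass.map_comp_comul_apply θ c).trans (map_val_val_comul (θ' c)).symm

end IsHopfSubalgebra

end HopfSubalgebras

section HopfSubalgebraOfInvariants

theorem mem_range_map_subtype_ker {k V W : Type*} [Field k] [AddCommGroup V] [Module k V]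
    [AddCommGroup W] [Module k W] {l : V →ₗ[k] W} {z : V ⊗[k] V} (hr : l.rTensor V z = 0)
    (hl : l.lTensor V z = 0) :
    z ∈ LinearMap.range (TensorProduct.map l.ker.subtype l.ker.subtype) := by
  obtain ⟨y, rfl⟩ := (Module.Flat.rTensor_exact V l.exact_subtype_ker_map z).mp hr
  have hy : l.lTensor l.ker y = 0 := by
    refine Module.Flat.rTensor_preserves_injective_linearMap _ l.ker.injective_subtype ?_
    rw [map_zero, ← hl]
    simp only [← LinearMap.comp_apply, LinearMap.rTensor_comp_lTensor,
      LinearMap.lTensor_comp_rTensor]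
  obtain ⟨x, rfl⟩ := (Module.Flat.lTensor_exact l.ker l.exact_subtype_ker_map y).mp hy
  exact ⟨x, by simp only [← LinearMap.comp_apply, LinearMap.rTensor_comp_lTensor]⟩

theorem mem_range_map_val_equalizer {k A R : Type*} [Field k] [CommRing A] [Algebra k A]
    [CommRing R] [Algebra k R] {ρ τ : A →ₐ[k] R} {z : A ⊗[k] A}
    (hr : Algebra.TensorProduct.map ρ (.id k A) z = Algebra.TensorProduct.map τ (.id k A) z)
    (hl : Algebra.TensorProduct.map (.id k A) ρ z = Algebra.TensorProduct.map (.id k A) τ z) :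
    z ∈ (Algebra.TensorProduct.map (AlgHom.equalizer ρ τ).val
      (AlgHom.equalizer ρ τ).val).range := by
  let l : A →ₗ[k] R := ρ.toLinearMap - τ.toLinearMap
  obtain ⟨w, rfl⟩ := mem_range_map_subtype_ker (l := l) (z := z)
    (by rw [LinearMap.rTensor_sub]; exact sub_eq_zero.mpr hr)
    (by rw [LinearMap.lTensor_sub]; exact sub_eq_zero.mpr hl)
  let i : l.ker →ₗ[k] AlgHom.equalizer ρ τ :=
    Submodule.inclusion (show l.ker ≤ (AlgHom.equalizer ρ τ).toSubmodule from
      fun _ ha => sub_eq_zero.mp ha)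
  refine ⟨TensorProduct.map i i w, ?_⟩
  exact LinearMap.congr_fun (TensorProduct.map_comp (AlgHom.equalizer ρ τ).val.toLinearMap
    (AlgHom.equalizer ρ τ).val.toLinearMap i i).symm w

section Points

variable {k A R S : Type*} [CommRing k] [CommRing A] [HopfAlgebra k A] [CommRing R] [Algebra k R]
  [CommRing S] [Algebra k S]

theorem Point.tensorMap_comul (g : Point k A R) (h : Point k A S) (a : A) :
    Algebra.TensorProduct.map g.ofConv h.ofConv (comul a) =
      (Point.map Algebra.TensorProduct.includeLeft g *
        Point.map Algebra.TensorProduct.includeRight h : Point k A (R ⊗[k] S)) a := by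
  rw [Point.mul_apply_of_comul_eq (ℛ k a).eq.symm, ← (ℛ k a).eq, map_sum]
  simp

variable {I : Ideal A} {a : A} {n : Point k A R}

theorem mul_apply_of_mem_invariants [I.IsHopfIdeal k] (ha : a ∈ invariants k I) (g : Point k A R)
    (hn : n ∈ vanishingOn k R I) : (g * n) a = g a := by
  have h := mul_apply_of_mem_semiInvariants (f := 1) (mem_semiInvariants.mpr ha) g hn
  rwa [map_one, mul_one] at h

theorem mul_mul_apply_of_mem_invariants [IsNormalHopfIdeal k I] (ha : a ∈ invariants k I)
    (g h : Point k A R) (hn : n ∈ vanishingOn k R I) : (g * n * h) a = (g * h) a := by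
  have hconj : h⁻¹ * n * h ∈ vanishingOn k R I := by
    simpa using normal_vanishingOn.conj_mem n hn h⁻¹
  rw [← mul_apply_of_mem_invariants ha (g * h) hconj]
  congr 1
  group

theorem antipode_mem_invariants [IsNormalHopfIdeal k I] (ha : a ∈ invariants k I) :
    HopfAlgebra.antipode k a ∈ invariants k I := by
  let g := Point.generic k A (A ⧸ I)
  let n := Point.genericOn k I
  have hn : n⁻¹ ∈ vanishingOn k _ I := inv_mem genericOn_mem_vanishingOn
  refine (coaction_eq_mul _).trans ?_
  calc (g * n) (HopfAlgebra.antipode k a) = (1 * n⁻¹ * g⁻¹) a := by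
        rw [← Point.inv_apply, mul_inv_rev, one_mul]
    _ = g⁻¹ a := by rw [mul_mul_apply_of_mem_invariants ha _ _ hn, one_mul]

end Points

instance {k A : Type*} [Field k] [CommRing A] [HopfAlgebra k A] {I : Ideal A}
    [IsNormalHopfIdeal k I] : IsHopfSubalgebra k (invariants k I) where
  antipode_mem _ := antipode_mem_invariants
  comul_mem a ha := by
    let g := Point.generic k A (A ⧸ I)
    let n := Point.genericOn k I
    have hcoaction : coaction k I = (g * n).ofConv := AlgHom.ext coaction_eq_mul
    have hn : n ∈ vanishingOn k _ I := genericOn_mem_vanishingOn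
    let id : Point k A A := toConv (.id k A)
    refine mem_range_map_val_equalizer ?_ ?_ <;> rw [hcoaction]
    · refine (Point.tensorMap_comul (g * n) id a).trans
        (.trans ?_ (Point.tensorMap_comul g id a).symm)
      rw [map_mul]
      exact mul_mul_apply_of_mem_invariants ha _ _ (map_mem_vanishingOn _ hn)
    · refine (Point.tensorMap_comul id (g * n) a).trans
        (.trans ?_ (Point.tensorMap_comul id g a).symm)
      rw [map_mul, ← mul_assoc]
      exact mul_apply_of_mem_invariants ha _ (map_mem_vanishingOn _ hn)

theorem mem_vanishingOn_iff_forall_mem_invariants {k A R : Type*} [Field k] [CommRing A]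
    [HopfAlgebra k A] [CommRing R] [Algebra k R] {I : Ideal A} [IsNormalHopfIdeal k I]
    {n : Point k A R} :
    n ∈ vanishingOn k R I ↔ ∀ b ∈ invariants k I, n b = algebraMap k R (counit b) := by
  refine ⟨fun hn b hb => ?_, fun h => mem_vanishingOn.mpr ?_⟩
  · rw [← one_mul n, mul_apply_of_mem_invariants hb 1 hn, AlgHom.convOne_apply]
  · suffices I ≤ RingHom.ker n.ofConv from fun a ha => this ha
    rw [← augmentationSpan_invariants (k := k) I, augmentationSpan, Ideal.span_le]
    rintro b ⟨hb, hb₀⟩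
    exact (h b hb).trans (by rw [hb₀, map_zero])

end HopfSubalgebraOfInvariants

variable {k : Type u} [Field k] [SigmaRing k]

/-- Compatibility of an algebra structure with `σ`: the unbundled form of `SigmaAlg`. -/
class IsSigmaAlgebra (k R : Type u) [Field k] [SigmaRing k] [CommRing R] [Algebra k R]
    [SigmaRing R] : Prop where
  sigma_algebraMap : ∀ c : k, σ (algebraMap k R c) = algebraMap k R (σ c)

section TensorProduct

variable {R S T : Type u} [CommRing R] [Algebra k R] [SigmaRing R] [IsSigmaAlgebra k R]
  [CommRing S] [Algebra k S] [SigmaRing S] [IsSigmaAlgebra k S]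

noncomputable instance : SigmaRing (R ⊗[k] S) where
  sigma := Algebra.TensorProduct.mapRingHom σ σ σ
    (RingHom.ext IsSigmaAlgebra.sigma_algebraMap) (RingHom.ext IsSigmaAlgebra.sigma_algebraMap)

theorem sigma_tmul (r : R) (s : S) : (σ (r ⊗ₜ s : R ⊗[k] S) : R ⊗[k] S) = σ r ⊗ₜ σ s :=
  Algebra.TensorProduct.mapRingHom_tmul _ _ _ (RingHom.ext IsSigmaAlgebra.sigma_algebraMap)
    (RingHom.ext IsSigmaAlgebra.sigma_algebraMap) r s

instance : IsSigmaAlgebra k (R ⊗[k] S) where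
  sigma_algebraMap c := by
    rw [Algebra.TensorProduct.algebraMap_apply, sigma_tmul, map_one,
      IsSigmaAlgebra.sigma_algebraMap, Algebra.TensorProduct.algebraMap_apply]

theorem lift_sigma [CommRing T] [Algebra k T] [SigmaRing T] {f : R →ₐ[k] T} {g : S →ₐ[k] T}
    (hf : ∀ r, f (σ r) = σ (f r)) (hg : ∀ s, g (σ s) = σ (g s)) (w : R ⊗[k] S) :
    Algebra.TensorProduct.lift f g (fun _ _ => Commute.all _ _) (σ w) =
      σ (Algebra.TensorProduct.lift f g (fun _ _ => Commute.all _ _) w) := by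
  induction w with
  | zero => simp
  | add x y hx hy => simp only [map_add, hx, hy]
  | tmul x y => simp [sigma_tmul, hf, hg]

theorem tensorMap_sigma {R' S' : Type u} [CommRing R'] [Algebra k R'] [SigmaRing R']
    [IsSigmaAlgebra k R'] [CommRing S'] [Algebra k S'] [SigmaRing S'] [IsSigmaAlgebra k S']
    {f : R →ₐ[k] R'} {g : S →ₐ[k] S'}
    (hf : ∀ r, f (σ r) = σ (f r)) (hg : ∀ s, g (σ s) = σ (g s)) (w : R ⊗[k] S) :
    Algebra.TensorProduct.map f g (σ w) = σ (Algebra.TensorProduct.map f g w) := by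
  induction w with
  | zero => simp
  | add x y hx hy => simp only [map_add, hx, hy]
  | tmul x y => simp [sigma_tmul, hf, hg]

end TensorProduct

instance : IsSigmaAlgebra k k := ⟨fun _ => rfl⟩

namespace SigmaAlg

variable {R S T R' S' : SigmaAlg k}

instance : IsSigmaAlgebra k R := ⟨R.sigma_algebraMap⟩

variable (k) in
/-- The bundled form of a `k`-`σ`-algebra. -/
abbrev of (R : Type u) [CommRing R] [Algebra k R] [SigmaRing R] [IsSigmaAlgebra k R] :
    SigmaAlg k where
  carrier := R
  sigma_algebraMap := IsSigmaAlgebra.sigma_algebraMap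

/-- The underlying algebra morphism of a morphism of `k`-`σ`-algebras. -/
abbrev algHom (f : R ⟶ S) : R →ₐ[k] S := Hom.toAlgHom f

theorem hom_ext {f g : R ⟶ S} (h : algHom f = algHom g) : f = g := Hom.ext h

theorem algHom_sigma (f : R ⟶ S) (r : R) : algHom f (σ r) = σ (algHom f r) := Hom.map_sigma f r

variable (R S) in
/-- The first inclusion into the tensor product, which is the coproduct of `k`-`σ`-algebras. -/
noncomputable def inl : R ⟶ of k (R ⊗[k] S) where
  toAlgHom := Algebra.TensorProduct.includeLeft
  map_sigma r := by simp [sigma_tmul]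

variable (R S) in
/-- The second inclusion into the tensor product, which is the coproduct of `k`-`σ`-algebras. -/
noncomputable def inr : S ⟶ of k (R ⊗[k] S) where
  toAlgHom := Algebra.TensorProduct.includeRight
  map_sigma r := by simp [sigma_tmul]

/-- The morphism out of the coproduct with given components. -/
noncomputable def desc (f : R ⟶ T) (g : S ⟶ T) : of k (R ⊗[k] S) ⟶ T where
  toAlgHom := Algebra.TensorProduct.lift (algHom f) (algHom g) fun _ _ => Commute.all _ _
  map_sigma := lift_sigma (algHom_sigma f) (algHom_sigma g)

theorem inl_desc (f : R ⟶ T) (g : S ⟶ T) : inl R S ≫ desc f g = f :=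
  hom_ext (Algebra.TensorProduct.lift_comp_includeLeft (algHom f) (algHom g)
    fun _ _ => Commute.all _ _)

theorem inr_desc (f : R ⟶ T) (g : S ⟶ T) : inr R S ≫ desc f g = g :=
  hom_ext (Algebra.TensorProduct.lift_comp_includeRight (algHom f) (algHom g)
    fun _ _ => Commute.all _ _)

theorem tensor_hom_ext {f g : of k (R ⊗[k] S) ⟶ T} (hl : inl R S ≫ f = inl R S ≫ g)
    (hr : inr R S ≫ f = inr R S ≫ g) : f = g :=
  hom_ext (Algebra.TensorProduct.ext (congrArg algHom hl) (congrArg algHom hr))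

theorem desc_comp (f : R ⟶ S') (g : S ⟶ S') (h : S' ⟶ T) : desc f g ≫ h = desc (f ≫ h) (g ≫ h) :=
  tensor_hom_ext (by rw [← Category.assoc, inl_desc, inl_desc])
    (by rw [← Category.assoc, inr_desc, inr_desc])

/-- The tensor product of two morphisms of `k`-`σ`-algebras. -/
noncomputable def tensorHom (f : R ⟶ R') (g : S ⟶ S') : of k (R ⊗[k] S) ⟶ of k (R' ⊗[k] S') where
  toAlgHom := Algebra.TensorProduct.map (algHom f) (algHom g)
  map_sigma := tensorMap_sigma (algHom_sigma f) (algHom_sigma g)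

theorem tensorHom_eq_desc (f : R ⟶ R') (g : S ⟶ S') :
    tensorHom f g = desc (f ≫ inl R' S') (g ≫ inr R' S') :=
  tensor_hom_ext ((hom_ext (Algebra.TensorProduct.map_comp_includeLeft _ _)).trans
      (inl_desc _ _).symm)
    ((hom_ext (Algebra.TensorProduct.map_comp_includeRight _ _)).trans (inr_desc _ _).symm)

variable (R S T) in
/-- The associativity constraint for tensor products of `k`-`σ`-algebras. -/
noncomputable def assoc :
    of k (of k (R ⊗[k] S) ⊗[k] T) ⟶ of k (R ⊗[k] of k (S ⊗[k] T)) :=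
  desc (desc (inl _ _) (inl _ _ ≫ inr _ _)) (inr _ _ ≫ inr _ _)

theorem algHom_assoc :
    algHom (assoc R S T) = (Algebra.TensorProduct.assoc k k k R S T).toAlgHom := by
  have h₁ : inl _ _ ≫ inl _ _ ≫ assoc R S T = inl _ _ := by rw [assoc, inl_desc, inl_desc]
  have h₂ : inr _ _ ≫ inl _ _ ≫ assoc R S T = inl _ _ ≫ inr _ _ := by
    rw [assoc, inl_desc, inr_desc]
  have h₃ : inr _ _ ≫ assoc R S T = inr _ _ ≫ inr _ _ := inr_desc _ _
  exact Algebra.TensorProduct.ext (Algebra.TensorProduct.ext (congrArg algHom h₁)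
    (congrArg algHom h₂)) (congrArg algHom h₃)

/-- The structure morphism of a `k`-`σ`-algebra, from the initial object `k`. -/
def ofBase (R : SigmaAlg k) : of k k ⟶ R where
  toAlgHom := Algebra.ofId k R
  map_sigma c := (R.sigma_algebraMap c).symm

theorem eq_ofBase (f : of k k ⟶ R) : f = ofBase R :=
  hom_ext (Subsingleton.elim (α := k →ₐ[k] R) _ _)

end SigmaAlg

open SigmaAlg

/-- Compatibility of a Hopf algebra structure with `σ`. -/
class IsSigmaHopfAlgebra (k A : Type u) [Field k] [SigmaRing k] [CommRing A] [HopfAlgebra k A]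
    [SigmaRing A] : Prop extends IsSigmaAlgebra k A where
  comul_sigma : ∀ a : A, comul (R := k) (σ a) = (σ (comul (R := k) a) : A ⊗[k] A)
  counit_sigma : ∀ a : A, counit (R := k) (σ a) = (σ (counit (R := k) a) : k)
  antipode_sigma : ∀ a : A, HopfAlgebra.antipode k (σ a) = σ (HopfAlgebra.antipode k a)

section Spec

variable (k) (A B : Type u) [CommRing A] [HopfAlgebra k A] [SigmaRing A] [IsSigmaHopfAlgebra k A]
  [CommRing B] [HopfAlgebra k B] [SigmaRing B] [IsSigmaHopfAlgebra k B] (S : SigmaAlg k)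

/-- The points of `Spec(A)` that commute with `σ`, that is, the morphisms `A → S` of
`k`-`σ`-algebras. -/
noncomputable def sigmaPoints : Subgroup (Point k A S) where
  carrier := {g | ∀ a, g (σ a) = σ (g a)}
  mul_mem' {g h} hg hh a := by
    rw [AlgHom.convMul_apply, AlgHom.convMul_apply, IsSigmaHopfAlgebra.comul_sigma]
    exact lift_sigma hg hh _
  one_mem' a := by
    rw [AlgHom.convOne_apply, AlgHom.convOne_apply, IsSigmaHopfAlgebra.counit_sigma,
      S.sigma_algebraMap]
  inv_mem' {g} hg a := by
    rw [Point.inv_apply, Point.inv_apply, IsSigmaHopfAlgebra.antipode_sigma]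
    exact hg _

variable {k A B S}

/-- The morphisms `A → S` of `k`-`σ`-algebras as points of `Spec(A)`. -/
noncomputable def homEquivSigmaPoints : (SigmaAlg.of k A ⟶ S) ≃ sigmaPoints k A S where
  toFun f := ⟨toConv (algHom f), algHom_sigma f⟩
  invFun g := ⟨g.1.ofConv, g.2⟩
  left_inv _ := rfl
  right_inv _ := rfl

theorem map_mem_sigmaPoints {T : SigmaAlg k} (f : S ⟶ T) {g : Point k A S}
    (hg : g ∈ sigmaPoints k A S) : Point.map (algHom f) g ∈ sigmaPoints k A T := fun a => by
  rw [Point.map_apply, hg, algHom_sigma, Point.map_apply]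

variable (k A) in
/-- The group `k`-`σ`-scheme represented by a Hopf algebra with compatible `σ`. -/
noncomputable def spec : GroupSigmaScheme k where
  toFunctor :=
    { obj S := GrpCat.of (sigmaPoints k A S)
      map f := GrpCat.ofHom (((Point.map (algHom f)).comp (sigmaPoints k A _).subtype).codRestrict _
        fun g => map_mem_sigmaPoints f g.2) }
  isCorepresentable := ⟨SigmaAlg.of k A, ⟨
    { homEquiv := homEquivSigmaPoints
      homEquiv_comp _ _ := rfl }⟩⟩

/-- The morphism of group `k`-`σ`-schemes dual to a morphism of Hopf algebras commuting with
`σ`. -/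
noncomputable def specMap (θ : A →ₐc[k] B) (hθ : ∀ a, θ (σ a) = σ (θ a)) :
    (spec k B).toFunctor ⟶ (spec k A).toFunctor where
  app S := GrpCat.ofHom (((Point.comap θ).comp (sigmaPoints k B S).subtype).codRestrict
    (sigmaPoints k A S) fun g a => (congrArg (g : Point k B S) (hθ a)).trans (g.2 (θ a)))

end Spec

section SigmaSubalgebra

variable {k A : Type u} [Field k] [CommRing A] [SigmaRing A]

/-- A subalgebra stable under `σ`. -/
class IsSigmaSubalgebra [Algebra k A] (B : Subalgebra k A) : Prop where
  sigma_mem : ∀ b ∈ B, σ b ∈ B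

noncomputable instance [Algebra k A] (B : Subalgebra k A) [IsSigmaSubalgebra B] : SigmaRing B where
  sigma := (σ.comp B.val.toRingHom).codRestrict B fun b => IsSigmaSubalgebra.sigma_mem (b : A) b.2

theorem coe_sigma [Algebra k A] {B : Subalgebra k A} [IsSigmaSubalgebra B] (b : B) :
    ((σ b : B) : A) = σ (b : A) := rfl

variable [SigmaRing k] [HopfAlgebra k A] [IsSigmaHopfAlgebra k A]

instance (B : Subalgebra k A) [IsSigmaSubalgebra B] : IsSigmaAlgebra k B where
  sigma_algebraMap c := Subtype.ext (IsSigmaAlgebra.sigma_algebraMap c)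

instance (B : Subalgebra k A) [IsSigmaSubalgebra B] [IsHopfSubalgebra k B] :
    IsSigmaHopfAlgebra k B where
  sigma_algebraMap := IsSigmaAlgebra.sigma_algebraMap
  comul_sigma b := by
    apply IsHopfSubalgebra.map_val_val_injective
    rw [IsHopfSubalgebra.map_val_val_comul, tensorMap_sigma coe_sigma coe_sigma, coe_sigma,
      IsSigmaHopfAlgebra.comul_sigma, IsHopfSubalgebra.map_val_val_comul]
  counit_sigma b := IsSigmaHopfAlgebra.counit_sigma (b : A)
  antipode_sigma b := Subtype.ext (IsSigmaHopfAlgebra.antipode_sigma (b : A))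

end SigmaSubalgebra

section SigmaIdeals

variable {k A : Type u} [Field k] [SigmaRing k] [CommRing A] [HopfAlgebra k A] [SigmaRing A]
  [IsSigmaHopfAlgebra k A]
  (I : SigmaIdeal (of k A))

instance : SigmaRing (A ⧸ I.ideal) := I.quotient.sigmaRing

instance : IsSigmaAlgebra k (A ⧸ I.ideal) := ⟨I.quotient.sigma_algebraMap⟩

theorem generic_mem_sigmaPoints :
    Point.generic k A (A ⧸ I.ideal) ∈ sigmaPoints k A (of k (A ⊗[k] (A ⧸ I.ideal))) :=
  algHom_sigma (inl (of k A) I.quotient)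

theorem genericOn_mem_sigmaPoints :
    Point.genericOn k I.ideal ∈ sigmaPoints k A (of k (A ⊗[k] (A ⧸ I.ideal))) :=
  algHom_sigma (I.proj ≫ inr (of k A) I.quotient)

instance : IsSigmaSubalgebra (invariants k I.ideal) where
  sigma_mem b hb := by
    have hσ := mul_mem (generic_mem_sigmaPoints I) (genericOn_mem_sigmaPoints I) b
    rw [← coaction_eq_mul, ← coaction_eq_mul, mem_invariants.mp hb, sigma_tmul, map_one] at hσ
    exact hσ

variable {I}

theorem isNormalHopfIdeal_of_sigmaPoints (M : ∀ S, Subgroup (sigmaPoints k A S))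
    (hM : ∀ S g, g ∈ M S ↔ ∀ a ∈ I.ideal, (g : Point k A S) a = 0)
    (hnormal : ∀ S, (M S).Normal) : IsNormalHopfIdeal k I.ideal := by
  let C := A ⧸ I.ideal
  let p {S} (f : I.quotient ⟶ S) : sigmaPoints k A S := homEquivSigmaPoints (I.proj ≫ f)
  have hp {S} (f : I.quotient ⟶ S) : p f ∈ M S := (hM S _).mpr fun a ha => by
    refine (congrArg (algHom f) (Ideal.Quotient.eq_zero_iff_mem.mpr ha)).trans (map_zero _)
  let g : sigmaPoints k A (of k (A ⊗[k] C)) := ⟨_, generic_mem_sigmaPoints I⟩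
  refine
    { counit_eq_zero := fun a ha => ?_
      map_mkQ_comul_eq_zero := fun a ha => ?_
      antipode_mem := fun a ha => ?_
      conj_apply_eq_zero :=
        (hM _ _).mp ((hnormal _).conj_mem _ (hp (inr (of k A) I.quotient)) g) }
  · simpa using (hM (of k k) 1).mp (one_mem _) a ha
  · exact (Point.tensorMap_comul (toConv (Ideal.Quotient.mkₐ k I.ideal))
      (toConv (Ideal.Quotient.mkₐ k I.ideal)) a).trans ((hM _ _).mp (mul_mem
        (hp (inl I.quotient I.quotient)) (hp (inr I.quotient I.quotient))) a ha)
  · exact Ideal.Quotient.eq_zero_iff_mem.mp ((hM _ _).mp (inv_mem (hp (𝟙 _))) a ha)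

end SigmaIdeals

section SpecHom

variable {k : Type u} [Field k] [SigmaRing k] {A B : Type u} [CommRing A] [HopfAlgebra k A]
  [SigmaRing A] [IsSigmaHopfAlgebra k A] [CommRing B] [HopfAlgebra k B] [SigmaRing B]
  [IsSigmaHopfAlgebra k B] {S : SigmaAlg k}

theorem homEquivSigmaPoints_mul {f g h : of k A ⟶ S}
    (hcomul : ∀ a, algHom h a = algHom (desc f g) (comul a)) :
    homEquivSigmaPoints h = homEquivSigmaPoints f * homEquivSigmaPoints g :=
  Subtype.ext (WithConv.ext (AlgHom.ext fun a =>
    (hcomul a).trans (AlgHom.convMul_apply (toConv (algHom f)) (toConv (algHom g)) a).symm))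

/-- The group homomorphism given by `φ` on `S`-valued points. -/
noncomputable def specApp (φ : (spec k A).toFunctor ⟶ (spec k B).toFunctor) (S : SigmaAlg k) :
    sigmaPoints k A S →* sigmaPoints k B S :=
  (φ.app S).hom

/-- The image under `φ` of the universal point of `spec k A`: by the Yoneda lemma, it determines
`φ`. -/
noncomputable def universalImage (φ : (spec k A).toFunctor ⟶ (spec k B).toFunctor) :
    sigmaPoints k B (of k A) :=
  specApp φ (of k A) (homEquivSigmaPoints (𝟙 (of k A)))

theorem specApp_apply_eq_universalImage (φ : (spec k A).toFunctor ⟶ (spec k B).toFunctor)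
    (g : sigmaPoints k A S) (b : B) : (specApp φ S g).1 b = g.1 ((universalImage φ).1 b) := by
  have hnat := ConcreteCategory.congr_hom (φ.naturality (homEquivSigmaPoints.symm g))
    (homEquivSigmaPoints (𝟙 (of k A)))
  exact congrArg (fun h : sigmaPoints k B S => h.1 b) hnat

theorem counit_universalImage (φ : (spec k A).toFunctor ⟶ (spec k B).toFunctor) (b : B) :
    counit (R := k) ((universalImage φ).1 b) = counit (R := k) b := by
  have h := specApp_apply_eq_universalImage φ (1 : sigmaPoints k A (of k k)) b
  rw [map_one] at h
  exact h.symm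

theorem tensorMap_universalImage_comul (φ : (spec k A).toFunctor ⟶ (spec k B).toFunctor) (b : B) :
    Algebra.TensorProduct.map (universalImage φ).1.ofConv (universalImage φ).1.ofConv (comul b) =
      comul (R := k) ((universalImage φ).1 b) := by
  let A₂ := of k (A ⊗[k] A)
  let x : sigmaPoints k A A₂ := homEquivSigmaPoints (inl (of k A) (of k A))
  let y : sigmaPoints k A A₂ := homEquivSigmaPoints (inr (of k A) (of k A))
  let u := universalImage φ
  have hx : (specApp φ _ x).1 = Point.map Algebra.TensorProduct.includeLeft u.1 :=
    WithConv.ext (AlgHom.ext (specApp_apply_eq_universalImage φ x))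
  have hy : (specApp φ _ y).1 = Point.map Algebra.TensorProduct.includeRight u.1 :=
    WithConv.ext (AlgHom.ext (specApp_apply_eq_universalImage φ y))
  calc Algebra.TensorProduct.map u.1.ofConv u.1.ofConv (comul b)
      = (Point.map Algebra.TensorProduct.includeLeft u.1 *
          Point.map Algebra.TensorProduct.includeRight u.1 : Point k B (A ⊗[k] A)) b :=
        Point.tensorMap_comul u.1 u.1 b
    _ = (specApp φ A₂ (x * y)).1 b := by rw [← hx, ← hy, map_mul]; rfl
    _ = (x * y).1 (u.1 b) := specApp_apply_eq_universalImage φ (x * y) b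
    _ = Algebra.TensorProduct.map (.id k A) (.id k A) (comul (u.1 b)) :=
        (Point.tensorMap_comul (toConv (.id k A)) (toConv (.id k A)) (u.1 b)).symm
    _ = comul (u.1 b) := by rw [Algebra.TensorProduct.map_id]; rfl

/-- The morphism of Hopf algebras dual to a morphism between spectra. -/
noncomputable def coHom (φ : (spec k A).toFunctor ⟶ (spec k B).toFunctor) : B →ₐc[k] A :=
  BialgHom.ofAlgHom (universalImage φ).1.ofConv (AlgHom.ext (counit_universalImage φ))
    (AlgHom.ext (tensorMap_universalImage_comul φ))

theorem coHom_sigma (φ : (spec k A).toFunctor ⟶ (spec k B).toFunctor) (b : B) :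
    coHom φ (σ b) = σ (coHom φ b) :=
  (universalImage φ).2 b

theorem specApp_apply (φ : (spec k A).toFunctor ⟶ (spec k B).toFunctor) (g : sigmaPoints k A S)
    (b : B) : (specApp φ S g).1 b = g.1 (coHom φ b) :=
  specApp_apply_eq_universalImage φ g b

theorem spec_hom_ext {φ ψ : (spec k A).toFunctor ⟶ (spec k B).toFunctor}
    (h : ∀ b, coHom φ b = coHom ψ b) : φ = ψ := by
  ext S g
  refine Subtype.ext (WithConv.ext (AlgHom.ext fun b => ?_))
  exact (specApp_apply φ g b).trans ((congrArg g.1 (h b)).trans (specApp_apply ψ g b).symm)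

theorem coHom_specMap_comp {C : Type u} [CommRing C] [HopfAlgebra k C] [SigmaRing C]
    [IsSigmaHopfAlgebra k C] (θ : B →ₐc[k] A) (hθ : ∀ b, θ (σ b) = σ (θ b))
    (ψ : (spec k B).toFunctor ⟶ (spec k C).toFunctor) (c : C) :
    coHom (specMap θ hθ ≫ ψ) c = θ (coHom ψ c) :=
  specApp_apply ψ (specApp (specMap θ hθ) (of k A) (homEquivSigmaPoints (𝟙 _))) c

end SpecHom

namespace GroupSigmaScheme

variable {k : Type u} [Field k] [SigmaRing k] (G : GroupSigmaScheme k) {S T : SigmaAlg k}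

/-- The coordinate ring `k{G}`. -/
noncomputable abbrev coordRing : SigmaAlg k := G.points.coreprX

/-- The element of `G(S)` given by a morphism `k{G} → S`. -/
noncomputable def elt (f : G.coordRing ⟶ S) : G.toFunctor.obj S := G.points.coreprW.hom.app S f

/-- The morphism `k{G} → S` given by an element of `G(S)`. -/
noncomputable def coord (x : G.toFunctor.obj S) : G.coordRing ⟶ S := G.points.coreprW.inv.app S x

variable {G}

theorem coord_elt (f : G.coordRing ⟶ S) : G.coord (G.elt f) = f :=
  ConcreteCategory.congr_hom (G.points.coreprW.hom_inv_id_app S) f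

theorem elt_coord (x : G.toFunctor.obj S) : G.elt (G.coord x) = x :=
  ConcreteCategory.congr_hom (G.points.coreprW.inv_hom_id_app S) x

theorem map_elt (f : G.coordRing ⟶ S) (φ : S ⟶ T) :
    (G.toFunctor.map φ).hom (G.elt f) = G.elt (f ≫ φ) :=
  (ConcreteCategory.congr_hom (G.points.coreprW.hom.naturality φ) f).symm

theorem coord_map (x : G.toFunctor.obj S) (φ : S ⟶ T) :
    G.coord ((G.toFunctor.map φ).hom x) = G.coord x ≫ φ :=
  ConcreteCategory.congr_hom (G.points.coreprW.inv.naturality φ) x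

variable (G)

/-- The comultiplication of `k{G}`. -/
noncomputable def comulHom : G.coordRing ⟶ of k (G.coordRing ⊗[k] G.coordRing) :=
  G.coord (G.elt (inl _ _) * G.elt (inr _ _))

/-- The counit of `k{G}`. -/
noncomputable def counitHom : G.coordRing ⟶ of k k := G.coord 1

/-- The antipode of `k{G}`. -/
noncomputable def antipodeHom : G.coordRing ⟶ G.coordRing := G.coord (G.elt (𝟙 _))⁻¹

variable {G}

theorem comulHom_comp (f : of k (G.coordRing ⊗[k] G.coordRing) ⟶ S) :
    G.comulHom ≫ f = G.coord (G.elt (inl _ _ ≫ f) * G.elt (inr _ _ ≫ f)) := by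
  rw [comulHom, ← coord_map, map_mul, map_elt, map_elt]

theorem coord_mul (x y : G.toFunctor.obj S) :
    G.coord (x * y) = G.comulHom ≫ desc (G.coord x) (G.coord y) := by
  rw [comulHom_comp, inl_desc, inr_desc, elt_coord, elt_coord]

theorem coord_one : G.coord (1 : G.toFunctor.obj S) = G.counitHom ≫ ofBase S := by
  rw [counitHom, ← coord_map, map_one]

variable (G)

theorem comulHom_coassoc :
    G.comulHom ≫ tensorHom G.comulHom (𝟙 _) ≫ assoc _ _ _ =
      G.comulHom ≫ tensorHom (𝟙 _) G.comulHom := by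
  simp only [tensorHom_eq_desc, desc_comp, assoc, Category.assoc, Category.id_comp, inl_desc,
    inr_desc]
  simp only [comulHom_comp, inl_desc, inr_desc, elt_coord, mul_assoc]

theorem comulHom_counit_left : G.comulHom ≫ tensorHom G.counitHom (𝟙 _) = inr (of k k) _ := by
  rw [tensorHom_eq_desc, comulHom_comp, inl_desc, inr_desc, eq_ofBase (inl _ _), ← coord_one,
    elt_coord, one_mul, coord_elt, Category.id_comp]

theorem comulHom_counit_right : G.comulHom ≫ tensorHom (𝟙 _) G.counitHom = inl _ (of k k) := by
  rw [tensorHom_eq_desc, comulHom_comp, inl_desc, inr_desc, eq_ofBase (inr _ _), ← coord_one,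
    elt_coord, mul_one, coord_elt, Category.id_comp]

theorem comulHom_antipode_left :
    G.comulHom ≫ desc G.antipodeHom (𝟙 _) = G.counitHom ≫ ofBase _ := by
  rw [comulHom_comp, inl_desc, inr_desc, ← coord_one, antipodeHom, elt_coord, inv_mul_cancel]

theorem comulHom_antipode_right :
    G.comulHom ≫ desc (𝟙 _) G.antipodeHom = G.counitHom ≫ ofBase _ := by
  rw [comulHom_comp, inl_desc, inr_desc, ← coord_one, antipodeHom, elt_coord, mul_inv_cancel]

noncomputable instance : Bialgebra k G.coordRing :=
  Bialgebra.ofAlgHom (algHom G.comulHom) (algHom G.counitHom)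
    (by rw [← algHom_assoc]; exact congrArg algHom G.comulHom_coassoc)
    (congrArg algHom G.comulHom_counit_left)
    (congrArg algHom G.comulHom_counit_right)

noncomputable instance : HopfAlgebra k G.coordRing :=
  HopfAlgebra.ofAlgHom (algHom G.antipodeHom) (congrArg algHom G.comulHom_antipode_left)
    (congrArg algHom G.comulHom_antipode_right)

instance : IsSigmaHopfAlgebra k G.coordRing where
  sigma_algebraMap := G.coordRing.sigma_algebraMap
  comul_sigma := algHom_sigma G.comulHom
  counit_sigma := algHom_sigma G.counitHom
  antipode_sigma := algHom_sigma G.antipodeHom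

/-- The elements of `G(S)` as points of the spectrum of `k{G}`. -/
noncomputable def pointEquiv (S : SigmaAlg k) :
    G.toFunctor.obj S ≃* sigmaPoints k G.coordRing S where
  toFun x := homEquivSigmaPoints (G.coord x)
  invFun g := G.elt (homEquivSigmaPoints.symm g)
  left_inv x := (congrArg G.elt (Equiv.symm_apply_apply _ _)).trans (elt_coord x)
  right_inv _ := (congrArg homEquivSigmaPoints (coord_elt _)).trans (Equiv.apply_symm_apply _ _)
  map_mul' x y := homEquivSigmaPoints_mul fun a => congrArg (algHom · a) (coord_mul x y)

/-- A group `k`-`σ`-scheme is the spectrum of its coordinate ring. -/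
noncomputable def specIso : G.toFunctor ≅ (spec k G.coordRing).toFunctor :=
  NatIso.ofComponents (fun S => (G.pointEquiv S).toGrpIso) fun f => by
    ext x
    exact congrArg (homEquivSigmaPoints (A := G.coordRing)) (coord_map x f)

end GroupSigmaScheme

section QuotientMap

variable {k A : Type u} [Field k] [SigmaRing k] [CommRing A] [HopfAlgebra k A] [SigmaRing A]
  [IsSigmaHopfAlgebra k A] (I : SigmaIdeal (of k A))

/-- The quotient of `spec k A` by the normal subgroup defined by `I`: it is dual to the inclusion
of the invariants. -/
noncomputable def quotientMap [IsNormalHopfIdeal k I.ideal] :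
    (spec k A).toFunctor ⟶ (spec k (invariants k I.ideal)).toFunctor :=
  specMap (IsHopfSubalgebra.val (invariants k I.ideal)) coe_sigma

theorem mem_kernel_quotientMap [IsNormalHopfIdeal k I.ideal] {S : SigmaAlg k}
    {g : sigmaPoints k A S} :
    g ∈ (kernel (quotientMap I)).obj S ↔ g.1 ∈ vanishingOn k S I.ideal :=
  .trans ⟨fun h b hb => congrArg (fun p : sigmaPoints k _ S => p.1 ⟨b, hb⟩) h,
    fun h => Subtype.ext (WithConv.ext (AlgHom.ext fun b => h b b.2))⟩
    mem_vanishingOn_iff_forall_mem_invariants.symm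

variable {I} in
theorem coHom_mem_invariants [I.ideal.IsHopfIdeal k] {B : Type u} [CommRing B] [HopfAlgebra k B]
    [SigmaRing B] [IsSigmaHopfAlgebra k B] (φ : (spec k A).toFunctor ⟶ (spec k B).toFunctor)
    (hφ : ∀ (S : SigmaAlg k) (g : sigmaPoints k A S), g.1 ∈ vanishingOn k S I.ideal →
      specApp φ S g = 1) (b : B) : coHom φ b ∈ invariants k I.ideal := by
  let S := of k (A ⊗[k] (A ⧸ I.ideal))
  let g : sigmaPoints k A S := ⟨_, generic_mem_sigmaPoints I⟩
  let n : sigmaPoints k A S := ⟨_, genericOn_mem_sigmaPoints I⟩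
  rw [mem_invariants, coaction_eq_mul]
  calc (g * n).1 (coHom φ b) = (specApp φ S (g * n)).1 b := (specApp_apply φ _ b).symm
    _ = (specApp φ S g).1 b := by rw [map_mul, hφ S n genericOn_mem_vanishingOn, mul_one]
    _ = g.1 (coHom φ b) := specApp_apply φ g b

theorem existsUnique_quotientMap_comp_eq [IsNormalHopfIdeal k I.ideal] {B : Type u} [CommRing B]
    [HopfAlgebra k B] [SigmaRing B] [IsSigmaHopfAlgebra k B]
    (φ : (spec k A).toFunctor ⟶ (spec k B).toFunctor)
    (hφ : kernel (quotientMap I) ≤ kernel φ) :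
    ∃! ψ : (spec k (invariants k I.ideal)).toFunctor ⟶ (spec k B).toFunctor,
      quotientMap I ≫ ψ = φ := by
  have hmem := coHom_mem_invariants φ fun S _ hg => hφ S ((mem_kernel_quotientMap I).mpr hg)
  refine ⟨specMap (IsHopfSubalgebra.codRestrict (coHom φ) hmem)
    fun b => Subtype.ext (coHom_sigma φ b), ?_, fun ψ hψ => spec_hom_ext fun b => Subtype.ext ?_⟩
  · exact spec_hom_ext fun b => coHom_specMap_comp _ _ _ b
  · exact (coHom_specMap_comp _ coe_sigma ψ b).symm.trans (congrArg (coHom · b) hψ)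

theorem kernel_le_kernel_comp {G H K : GroupSigmaScheme k} (φ : G.toFunctor ⟶ H.toFunctor)
    (ψ : H.toFunctor ⟶ K.toFunctor) : kernel φ ≤ kernel (φ ≫ ψ) := fun S _ hg =>
  (congrArg (ψ.app S).hom hg).trans (map_one _)

theorem isQuotient_quotientMap [IsNormalHopfIdeal k I.ideal] :
    IsQuotient (kernel (quotientMap I)) (quotientMap I) where
  le_kernel _ := le_rfl
  existsUnique_factor H φ hφ := by
    obtain ⟨ψ, hψ, huniq⟩ := existsUnique_quotientMap_comp_eq I (φ ≫ H.specIso.hom)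
      fun S => (hφ S).trans (kernel_le_kernel_comp φ _ S)
    refine ⟨ψ ≫ H.specIso.inv, ?_, fun ψ' hψ' => ?_⟩
    · exact (Category.assoc _ _ _).symm.trans ((Iso.comp_inv_eq _).mpr hψ)
    · exact (Iso.eq_comp_inv _).mpr <| huniq _ <|
        (Category.assoc _ _ _).symm.trans (congrArg (· ≫ H.specIso.hom) hψ')

end QuotientMap

section Quotients

variable {k : Type u} [Field k] [SigmaRing k] {G H K Q : GroupSigmaScheme k}

theorem IsQuotient.iso_hom_comp (e : G.toFunctor ≅ H.toFunctor) {π : H.toFunctor ⟶ Q.toFunctor}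
    (hπ : IsQuotient (kernel π) π) : IsQuotient (kernel (e.hom ≫ π)) (e.hom ≫ π) where
  le_kernel _ := le_rfl
  existsUnique_factor K φ hφ := by
    have hker : kernel π ≤ kernel (e.inv ≫ φ) := fun S g hg => by
      have he : (e.hom.app S).hom ((e.inv.app S).hom g) = g :=
        ConcreteCategory.congr_hom (e.inv_hom_id_app S) g
      have hmem : (e.inv.app S).hom g ∈ (kernel (e.hom ≫ π)).obj S :=
        (congrArg (π.app S).hom he).trans hg
      exact hφ S hmem
    simpa only [Iso.eq_inv_comp, ← Category.assoc] using hπ.existsUnique_factor K _ hker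

theorem IsQuotient.eq_kernel {N : SubgroupOf G} {π : G.toFunctor ⟶ Q.toFunctor}
    (hπ : IsQuotient N π) {φ : G.toFunctor ⟶ H.toFunctor} (hφ : N = kernel φ) : N = kernel π := by
  obtain ⟨ψ, rfl, -⟩ := hπ.existsUnique_factor H φ (hφ ▸ fun _ => le_rfl)
  refine SubgroupOf.ext (funext fun S => le_antisymm (hπ.le_kernel S) ?_)
  exact (kernel_le_kernel_comp π ψ S).trans_eq (congrArg (SubgroupOf.obj · S) hφ.symm)

theorem SigmaIdeal.exists_proj_comp_eq_iff {R S : SigmaAlg k} (I : SigmaIdeal R) {f : R ⟶ S} :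
    (∃ g : I.quotient ⟶ S, I.proj ≫ g = f) ↔ ∀ a ∈ I.ideal, algHom f a = 0 := by
  constructor
  · rintro ⟨g, rfl⟩ a ha
    exact (congrArg (algHom g) (Ideal.Quotient.eq_zero_iff_mem.mpr ha)).trans (map_zero _)
  · refine fun hf => ⟨⟨Ideal.Quotient.liftₐ I.ideal (algHom f) hf, fun r => ?_⟩, rfl⟩
    obtain ⟨r, rfl⟩ := Ideal.Quotient.mk_surjective r
    exact algHom_sigma f r

theorem SubgroupOf.exists_sigmaIdeal {N : SubgroupOf G}
    (hN : IsSigmaClosed G.points N.toSubfunctor) :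
    ∃ I : SigmaIdeal G.coordRing, ∀ (S : SigmaAlg k) (x : G.toFunctor.obj S),
      x ∈ N.obj S ↔ ∀ a ∈ I.ideal, (G.pointEquiv S x).1 a = 0 := by
  obtain ⟨I, e, he⟩ := hN
  have hcoord {S : SigmaAlg k} (y : N.toSubfunctor.toFunctor.obj S) :
      G.coord y.1 = I.proj ≫ e.hom.app S y :=
    congrFun (congrArg (fun f => (f.app S).hom) he) y
  refine ⟨I, fun S x => .trans ⟨fun hx => ⟨_, (hcoord ⟨x, hx⟩).symm⟩, ?_⟩
    I.exists_proj_comp_eq_iff⟩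
  rintro ⟨f, hf⟩
  have hy : e.hom.app S (e.inv.app S f) = f := ConcreteCategory.congr_hom (e.inv_hom_id_app S) f
  have hxy : G.coord (e.inv.app S f).1 = G.coord x := by rw [hcoord, hy, hf]
  rw [← G.elt_coord x, ← hxy, G.elt_coord]
  exact (e.inv.app S f).2

theorem SubgroupOf.IsNormalSigmaClosed.exists_isQuotient {N : SubgroupOf G}
    (hN : N.IsNormalSigmaClosed) : ∃ (Q : GroupSigmaScheme k) (π : G.toFunctor ⟶ Q.toFunctor),
      IsQuotient N π ∧ N = kernel π := by
  obtain ⟨I, hI⟩ := SubgroupOf.exists_sigmaIdeal hN.isSigmaClosed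
  let J : SigmaIdeal (of k G.coordRing) := I
  have hJ : IsNormalHopfIdeal k J.ideal := isNormalHopfIdeal_of_sigmaPoints
    (fun S => (N.obj S).comap (G.pointEquiv S).symm.toMonoidHom)
    (fun S g => (hI S _).trans (by
      rw [MulEquiv.coe_toMonoidHom, MulEquiv.apply_symm_apply]))
    fun S => (hN.normal S).comap _
  have hker : N = kernel (G.specIso.hom ≫ quotientMap J) := by
    refine SubgroupOf.ext (funext fun S => Subgroup.ext fun x => ?_)
    exact (hI S x).trans (mem_vanishingOn.symm.trans (mem_kernel_quotientMap J).symm)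
  exact ⟨_, _, hker ▸ (isQuotient_quotientMap J).iso_hom_comp G.specIso, hker⟩

end Quotients

end DifferenceAlgebra

theorem mainTheorem8 {k : Type u} [Field k] [DifferenceAlgebra.SigmaRing k]
    (G : DifferenceAlgebra.GroupSigmaScheme k) (N : DifferenceAlgebra.SubgroupOf G)
    (hN : N.IsNormalSigmaClosed) :
    (∃ (Q : DifferenceAlgebra.GroupSigmaScheme k) (π : G.toFunctor ⟶ Q.toFunctor),
      DifferenceAlgebra.IsQuotient N π) ∧
    (∀ (Q : DifferenceAlgebra.GroupSigmaScheme k) (π : G.toFunctor ⟶ Q.toFunctor),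
      DifferenceAlgebra.IsQuotient N π → N = DifferenceAlgebra.kernel π) := by
  obtain ⟨Q, π, hπ, hker⟩ := hN.exists_isQuotient
  exact ⟨⟨Q, π, hπ⟩, fun _ _ hπ' => hπ'.eq_kernel hker⟩
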